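/- **Setting.** Let $\mathcal S(\mathbb R)$ be the Schwartz space of real test functions, $C_0(\mathbb R)$ the space of continuous real functions vanishing at infinity, and $\mathcal M(\mathbb R)=C_0(\mathbb R)'$ with its dual norm $\|w\|_{\mathcal M}=\sup\{\langle w,\varphi\rangle:\varphi\in C_0(\mathbb R),\ \|\varphi\|_\infty=1\}$. Functions are real-valued, measurable, and identified when they agree almost everywhere. Let $\mathrm L$ be a linear shift-invariant operator, given by its formal adjoint $\mathrm L^*$, a linear map from $\mathcal S(\mathbb R)$ to measurable functions with $\mathrm L^*\{\varphi(\cdot-a)\}=(\mathrm L^*\varphi)(\cdot-a)$. It applies to the functions $f$ for which $\sup_{|a|\le R}\int_{\mathbb R}|f(x)\,\mathrm L^*\{\varphi(\cdot-a)\}(x)|\,dx<\infty$ for all $\varphi\in\mathcal S(\mathbb R)$ and $R>0$, and then $\langle \mathrm Lf,\varphi\rangle:=\int_{\mathbb R} f\,\mathrm L^*\varphi$. The search space is $$\mathcal X_1=\{f:\ \|\mathrm Lf\|_{\mathcal M}<\infty\},$$ i.e. the set of those $f$ for which there is a (necessarily unique) $\mathrm Lf\in\mathcal M(\mathbb R)$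 with $\int f\,\mathrm L^*\varphi=\langle \mathrm Lf,\varphi\rangle$ for all $\varphi\in\mathcal S(\mathbb R)$. Assume that $\mathrm L$ is spline-admissible: its null space $\mathcal N_{\mathrm L}=\{p\in\mathcal X_1:\mathrm Lp=0\}$ is finite-dimensional, with basis $p_1,\dots,p_{N_0}$, and it has a Green's function $\rho_{\mathrm L}\in\mathcal X_1$, $\mathrm L\rho_{\mathrm L}=\delta$. Let $\phi_1,\dots,\phi_{N_0}$ be linear functionals on $\mathcal X_1$ with $\langle\phi_m,p_n\rangle=1$ if $m=n$ and $0$ otherwise. The weak*-topology of $\mathcal X_1$ (with respect to $\mathrm L^*(C_0(\mathbb R))\oplus\operatorname{span}\{\phi_n\}$) is the coarsest topology for which $f\mapsto\langle \mathrm Lf,\psi\rangle$, $\psi\in C_0(\mathbb R)$, and $f\mapsto\langle\phi_n,f\rangle$, $n=1,\dots,N_0$, are continuous. Let $\mathrm H:\mathcal X_1\to\mathbb R^M$ be linear and weak*-continuous, with $\mathrm H\{q_1\}=\mathrm H\{q_2\}\Leftrightarrow q_1=q_2$ for all $q_1,q_2\in\mathcal N_{\mathrm L}$. Let $E:\mathbb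 R^M\times\mathbb R^M\to[0,\infty]$ and $\mathbf z\in\mathbb R^M$ be such that $E(\mathbf z,\cdot)$ is convex, lower semi-continuous and coercive ($E(\mathbf z,\mathbf y)\to\infty$ as $\|\mathbf y\|\to\infty$), and $E(\mathbf z,\mathrm H\{f\})<\infty$ for at least one $f\in\mathcal X_1$. Let $\lambda>0$. **Theorem.** The set $$\mathcal V=\arg\min_{f\in\mathcal X_1}\bigl(E(\mathbf z,\mathrm H\{f\})+\lambda\|\mathrm Lf\|_{\mathcal M}\bigr)$$ of minimizers is nonempty, convex and weak*-compact, and it is the weak*-closed convex hull of its extreme points. Every extreme point $f$ of $\mathcal V$ is a nonuniform $\mathrm L$-spline: there are $K\le M-N_0$, distinct knots $x_1,\dots,x_K\in\mathbb R$, and coefficients $\mathbf a\in\mathbb R^K$, $\mathbf b\in\mathbb R^{N_0}$ such that $$\mathrm Lf=\sum_{k=1}^K a_k\,\delta(\cdot-x_k),\qquad f=\sum_{k=1}^K a_k\,\rho_{\mathrm L}(\cdot-x_k)+\sum_{n=1}^{N_0}b_n\,p_n,\qquad \|\mathrm Lf\|_{\mathcal M}=\|\mathbf a\|_1 .$$ 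-/

import Mathlib

open MeasureTheory Set Filter Topology
open scoped SchwartzMap ZeroAtInfty ENNReal NNReal

noncomputable section

namespace GTV

/-- Real-valued measurable functions on the line, up to equality almost everywhere. -/
abbrev Fn : Type := ℝ →ₘ[volume] ℝ

/-- The space `𝓜(ℝ)`, as the topological dual of `C₀(ℝ)`. Its norm is the dual norm
`‖w‖ = sup {⟨w, φ⟩ : φ ∈ C₀(ℝ), ‖φ‖_∞ = 1}`, that is, the total variation. -/
abbrev Meas : Type := StrongDual ℝ C₀(ℝ, ℝ)

/-- The Dirac mass `δ(· - x)`. -/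
def dirac (x : ℝ) : Meas :=
  LinearMap.mkContinuous
    { toFun := fun φ : C₀(ℝ, ℝ) => φ x
      map_add' := fun _ _ => rfl
      map_smul' := fun _ _ => rfl } 1 (fun φ => by
        rw [one_mul, ← ZeroAtInftyContinuousMap.norm_toBCF_eq_norm]
        exact φ.toBCF.norm_coe_le_norm x)

/-- The shifted function `f(· - a)`. -/
def shift (a : ℝ) (f : Fn) : Fn :=
  f.compMeasurePreserving (fun x => x - a) (measurePreserving_sub_right volume a)

/-- The shifted test function `φ(· - a)`. -/
def shiftTest (a : ℝ) (φ : 𝓢(ℝ, ℝ)) : 𝓢(ℝ, ℝ) := φ.compSubConstCLM ℝ a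

theorem shiftTest_zero (φ : 𝓢(ℝ, ℝ)) : shiftTest 0 φ = φ := by
  simp [shiftTest]

/-- A linear shift-invariant operator `L` on generalized functions. It is given by its formal
adjoint `L*` on test functions, a linear map that sends test functions to functions and commutes
with shifts; `L f` is the functional `φ ↦ ⟨f, L* φ⟩`. -/
structure LSIOperator where
  adj : 𝓢(ℝ, ℝ) →ₗ[ℝ] Fn
  adj_shift : ∀ (a : ℝ) (φ : 𝓢(ℝ, ℝ)), adj (shiftTest a φ) = shift a (adj φ)

namespace LSIOperator

variable (L : LSIOperator)

/-- The functions `f` to which `L` applies: all integrals `⟨f, L*{φ(· - a)}⟩` converge absolutely,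
locally uniformly in the shift `a`. -/
def Applies (f : Fn) : Prop :=
  ∀ (φ : 𝓢(ℝ, ℝ)) (R : ℝ), ∃ C : ℝ≥0, ∀ a ∈ Icc (-R) R,
    ∫⁻ x, ‖f x * L.adj (shiftTest a φ) x‖ₑ ≤ C

/-- `L f = w` in the sense of generalized functions: `⟨f, L* φ⟩ = ⟨w, φ⟩` for all test functions. -/
def Maps (f : Fn) (w : Meas) : Prop :=
  ∀ φ : 𝓢(ℝ, ℝ), ∫ x, f x * L.adj φ x = w φ.toZeroAtInfty

theorem Applies.integrable {L : LSIOperator} {f : Fn} (hf : L.Applies f) (φ : 𝓢(ℝ, ℝ)) :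
    Integrable (fun x => f x * L.adj φ x) := by
  refine ⟨f.aestronglyMeasurable.mul (L.adj φ).aestronglyMeasurable, ?_⟩
  obtain ⟨C, hC⟩ := hf φ 0
  have h := hC 0 (by simp)
  rw [shiftTest_zero] at h
  exact lt_of_le_of_lt h ENNReal.coe_lt_top

theorem Applies.add {L : LSIOperator} {f g : Fn} (hf : L.Applies f) (hg : L.Applies g) :
    L.Applies (f + g) := by
  intro φ R
  obtain ⟨C, hC⟩ := hf φ R
  obtain ⟨D, hD⟩ := hg φ R
  refine ⟨C + D, fun a ha => ?_⟩
  calc ∫⁻ x, ‖(f + g) x * L.adj (shiftTest a φ) x‖ₑ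
      ≤ ∫⁻ x, (‖f x * L.adj (shiftTest a φ) x‖ₑ + ‖g x * L.adj (shiftTest a φ) x‖ₑ) := by
        refine lintegral_mono_ae ?_
        filter_upwards [AEEqFun.coeFn_add f g] with x hx
        rw [hx, Pi.add_apply, add_mul]
        exact enorm_add_le _ _
    _ = (∫⁻ x, ‖f x * L.adj (shiftTest a φ) x‖ₑ) + ∫⁻ x, ‖g x * L.adj (shiftTest a φ) x‖ₑ :=
        lintegral_add_left' (f.aestronglyMeasurable.mul
          (L.adj (shiftTest a φ)).aestronglyMeasurable).enorm _
    _ ≤ ((C + D : ℝ≥0) : ℝ≥0∞) := by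
        rw [ENNReal.coe_add]
        exact add_le_add (hC a ha) (hD a ha)

theorem Applies.smul {L : LSIOperator} {f : Fn} (c : ℝ) (hf : L.Applies f) :
    L.Applies (c • f) := by
  intro φ R
  obtain ⟨C, hC⟩ := hf φ R
  refine ⟨‖c‖₊ * C, fun a ha => ?_⟩
  calc ∫⁻ x, ‖(c • f) x * L.adj (shiftTest a φ) x‖ₑ
      = ∫⁻ x, ‖c‖ₑ * ‖f x * L.adj (shiftTest a φ) x‖ₑ := by
        refine lintegral_congr_ae ?_
        filter_upwards [AEEqFun.coeFn_smul c f] with x hx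
        rw [hx, Pi.smul_apply, smul_eq_mul, mul_assoc, enorm_mul]
    _ = ‖c‖ₑ * ∫⁻ x, ‖f x * L.adj (shiftTest a φ) x‖ₑ :=
        lintegral_const_mul' _ _ enorm_ne_top
    _ ≤ ((‖c‖₊ * C : ℝ≥0) : ℝ≥0∞) := by
        rw [ENNReal.coe_mul]
        exact mul_le_mul' le_rfl (hC a ha)

theorem Maps.add {L : LSIOperator} {f g : Fn} {v w : Meas} (hf : L.Applies f) (hg : L.Applies g)
    (hv : L.Maps f v) (hw : L.Maps g w) : L.Maps (f + g) (v + w) := by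
  intro φ
  rw [_root_.add_apply, ← hv φ, ← hw φ,
    ← integral_add (hf.integrable φ) (hg.integrable φ)]
  refine integral_congr_ae ?_
  filter_upwards [AEEqFun.coeFn_add f g] with x hx
  rw [hx, Pi.add_apply, add_mul]

theorem Maps.smul {L : LSIOperator} {f : Fn} {v : Meas} (c : ℝ) (hv : L.Maps f v) :
    L.Maps (c • f) (c • v) := by
  intro φ
  rw [_root_.smul_apply, ← hv φ, smul_eq_mul, ← integral_const_mul]
  refine integral_congr_ae ?_
  filter_upwards [AEEqFun.coeFn_smul c f] with x hx
  rw [hx, Pi.smul_apply, smul_eq_mul, mul_assoc]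

/-- The search space `𝓧₁ = {f : ‖L f‖_𝓜 < ∞}`: the functions to which `L` applies and whose image
under `L` is an element of `𝓜(ℝ)`. -/
def searchSpace : Submodule ℝ Fn where
  carrier := {f | L.Applies f ∧ ∃ w : Meas, L.Maps f w}
  zero_mem' := by
    have h0 : L.Applies 0 := by
      intro φ R
      refine ⟨0, fun a _ => ?_⟩
      refine le_of_eq ?_
      rw [ENNReal.coe_zero]
      refine (lintegral_congr_ae ?_).trans lintegral_zero
      filter_upwards [AEEqFun.coeFn_zero (α := ℝ) (β := ℝ) (μ := volume)] with x hx
      rw [hx]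
      simp
    refine ⟨h0, 0, fun φ => ?_⟩
    rw [_root_.zero_apply]
    refine (integral_congr_ae ?_).trans (integral_zero ℝ ℝ)
    filter_upwards [AEEqFun.coeFn_zero (α := ℝ) (β := ℝ) (μ := volume)] with x hx
    rw [hx]
    simp
  add_mem' := by
    rintro f g ⟨hf, v, hv⟩ ⟨hg, w, hw⟩
    exact ⟨hf.add hg, v + w, hv.add hf hg hw⟩
  smul_mem' := by
    rintro c f ⟨hf, v, hv⟩
    exact ⟨hf.smul c, c • v, hv.smul c⟩

end LSIOperator

/-- Test functions are dense in `C₀(ℝ)`. -/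
theorem denseRange_toZeroAtInfty :
    DenseRange (fun φ : 𝓢(ℝ, ℝ) => (φ.toZeroAtInfty : C₀(ℝ, ℝ))) := by
  intro g
  rw [Metric.mem_closure_range_iff]
  intro ε hε
  have hg : ∀ᶠ x in cocompact ℝ, |g x| < ε / 4 := by
    have h := g.zero_at_infty'.eventually (Metric.ball_mem_nhds (0 : ℝ) (by positivity : 0 < ε / 4))
    filter_upwards [h] with x hx
    simpa [Real.dist_eq] using hx
  obtain ⟨R, hR⟩ : ∃ R : ℝ, ∀ x : ℝ, R < |x| → |g x| < ε / 4 := by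
    rw [← Metric.cobounded_eq_cocompact] at hg
    obtain ⟨R, -, hR⟩ :=
      (Metric.hasBasis_cobounded_compl_closedBall (0 : ℝ)).eventually_iff.mp hg
    refine ⟨R, fun x hx => hR ?_⟩
    simpa [Real.dist_eq] using hx
  let χ : ContDiffBump (0 : ℝ) := ⟨max R 1, max R 1 + 1, by positivity, by linarith⟩
  have hc : Continuous (fun x => χ x * g x) := χ.continuous.mul g.continuous
  obtain ⟨h, h1, h2, h3⟩ := hc.exists_contDiff_approx (⊤ : ℕ∞) (ε := fun _ => ε / 4)
    continuous_const (fun _ => by positivity)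
  have hs : HasCompactSupport h := by
    refine χ.hasCompactSupport.mono (h3.trans ?_)
    intro x hx
    exact left_ne_zero_of_mul hx
  refine ⟨hs.toSchwartzMap h1, ?_⟩
  refine lt_of_le_of_lt (?_ : _ ≤ ε / 2) (by linarith)
  rw [← ZeroAtInftyContinuousMap.dist_toBCF_eq_dist,
    BoundedContinuousFunction.dist_le (by positivity)]
  intro x
  have e1 : dist (g x) (χ x * g x) ≤ ε / 4 := by
    rw [Real.dist_eq]
    by_cases hx : |x| ≤ max R 1
    · rw [χ.one_of_mem_closedBall (by simpa [χ, Real.dist_eq] using hx)]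
      simp
      positivity
    · have hx' := hR x (lt_of_le_of_lt (le_max_left _ _) (not_le.mp hx))
      have e : g x - χ x * g x = (1 - χ x) * g x := by ring
      rw [e, abs_mul, abs_of_nonneg (by linarith [χ.le_one (x := x)])]
      have := χ.nonneg (x := x)
      nlinarith [abs_nonneg (g x), χ.le_one (x := x)]
  have e2 := h2 x
  have e3 : dist (g x) (h x) ≤ ε / 2 := by
    have := dist_triangle_right (g x) (h x) (χ x * g x)
    linarith
  exact e3

theorem LSIOperator.Maps.unique {L : LSIOperator} {f : Fn} {v w : Meas}
    (hv : L.Maps f v) (hw : L.Maps f w) : v = w := by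
  have h : (v : C₀(ℝ, ℝ) → ℝ) = w := by
    refine denseRange_toZeroAtInfty.equalizer v.continuous w.continuous ?_
    funext φ
    exact (hv φ).symm.trans (hw φ)
  exact DFunLike.coe_injective h

namespace LSIOperator

variable (L : LSIOperator)

/-- The operator `L : 𝓧₁ → 𝓜(ℝ)`. -/
def op : L.searchSpace →ₗ[ℝ] Meas where
  toFun f := f.2.2.choose
  map_add' f g := (f + g).2.2.choose_spec.unique
    (f.2.2.choose_spec.add f.2.1 g.2.1 g.2.2.choose_spec)
  map_smul' c f := (c • f).2.2.choose_spec.unique (f.2.2.choose_spec.smul c)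

/-- The null space `𝓝_L = {p ∈ 𝓧₁ : L p = 0}`. -/
abbrev nullSpace : Submodule ℝ L.searchSpace := LinearMap.ker L.op

/-- `ρ` is a Green's function of `L`: it belongs to `𝓧₁` and `L ρ = δ`. -/
def IsGreen (ρ : Fn) : Prop :=
  ∃ h : ρ ∈ L.searchSpace, L.op ⟨ρ, h⟩ = dirac 0

/-- Spline-admissibility of a linear shift-invariant operator. -/
structure SplineAdmissible : Prop where
  finite_nullSpace : FiniteDimensional ℝ L.nullSpace
  exists_green : ∃ ρ : Fn, L.IsGreen ρ

/-- `f` is a nonuniform `L`-spline with knots `x₁, …, x_K` and weights `a₁, …, a_K`. -/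
def IsSpline (f : L.searchSpace) {K : ℕ} (x a : Fin K → ℝ) : Prop :=
  Function.Injective x ∧ L.op f = ∑ k, a k • dirac (x k)

/-- The linear functionals `φ₁, …, φ_{N₀}` on `𝓧₁` are biorthonormal to the basis `p` of the
null space. Such a system gives the projector `P f = ∑ ⟨φ_n, f⟩ p_n` of `𝓧₁` onto `𝓝_L` and the norm
`‖L f‖_𝓜 + ‖(⟨φ_n, f⟩)_n‖₂` of `𝓧₁`. -/
def Biorthonormal {N₀ : ℕ} (p : Module.Basis (Fin N₀) ℝ L.nullSpace)
    (φ : Fin N₀ → L.searchSpace →ₗ[ℝ] ℝ) : Prop :=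
  ∀ m n, φ m (p n) = if m = n then 1 else 0

/-- The weak* topology of `𝓧₁`, as the dual of the space `L*(C₀(ℝ)) ⊕ span {φ_n}`: the coarsest
topology for which all `f ↦ ⟨f, L*ψ⟩ = ⟨L f, ψ⟩` with `ψ ∈ C₀(ℝ)` and all `f ↦ ⟨φ_n, f⟩` are
continuous. -/
@[reducible]
def weakStar {N₀ : ℕ} (φ : Fin N₀ → L.searchSpace →ₗ[ℝ] ℝ) : TopologicalSpace L.searchSpace :=
  TopologicalSpace.induced
    (fun f => ((fun ψ => L.op f ψ, fun n => φ n f) : (C₀(ℝ, ℝ) → ℝ) × (Fin N₀ → ℝ)))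
    inferInstance

/-- The cost `E(z, H f) + lam ‖L f‖_𝓜`. -/
def cost {M : ℕ} (E : (Fin M → ℝ) → (Fin M → ℝ) → ℝ≥0∞) (z : Fin M → ℝ) (lam : ℝ)
    (H : L.searchSpace →ₗ[ℝ] (Fin M → ℝ)) (f : L.searchSpace) : ℝ≥0∞ :=
  E z (H f) + ENNReal.ofReal (lam * ‖L.op f‖)

/-- The set `𝓥` of minimizers of the cost over `𝓧₁`. -/
def minimizers {M : ℕ} (E : (Fin M → ℝ) → (Fin M → ℝ) → ℝ≥0∞) (z : Fin M → ℝ) (lam : ℝ)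
    (H : L.searchSpace →ₗ[ℝ] (Fin M → ℝ)) : Set L.searchSpace :=
  {f | ∀ g, L.cost E z lam H f ≤ L.cost E z lam H g}

end LSIOperator

end GTV

end

/-
The weak* topology of `𝓧₁` is induced by the injection `f ↦ (L f, (⟨φ_n, f⟩)_n)` into the dual
space `𝓜(ℝ) × ℝ^N₀`, and a weak*-continuous `H` extends to that space. There the relaxed problem
has a weak*-compact set of minimizers, because its sublevel sets are weak*-compact.

For a relaxed minimizer `(w, c)`, `w` has minimal norm among the functionals that agree with it on
the finitely many `ψ_i ∈ C₀(ℝ)` through which the extension of `H` sees them. By Hahn–Banach, `‖w‖`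
is the norm of `w` on the span of the `ψ_i`, so `w η = ‖w‖` for some `η ∈ C₀(ℝ)`, `‖η‖ ≤ 1`.
Hence `w = η μ` with a finite measure `μ` carried by the compact set `{|η| = 1}`. Convolution with
the Green's function is defined for such measures, so `w` is in the range of `L`: every relaxed
minimizer comes from `𝓧₁`, and the relaxation is exact.

If `f` is an extreme point and `L f = η μ`, then `f ± h` is again a minimizer for all small `h` with
`H h = 0` and `L h = η τ μ`, where `τ ∈ C₀(ℝ)`; so `h = 0`. Therefore `H` is injective on the `h`
with `L h = η τ μ`, a space of dimension at least `#s + N₀` for every finite `s ⊆ supp μ`, and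
the support of `μ` has at most `M - N₀` points.
-/

noncomputable section

namespace GTV

section RegularizedProblem

variable {X X' Y W : Type*} [AddCommGroup X] [Module ℝ X] [AddCommGroup X'] [Module ℝ X']
  [AddCommGroup Y] [Module ℝ Y] [SeminormedAddCommGroup W] [NormedSpace ℝ W]
  {E : Y → ℝ≥0∞} {lam : ℝ} {H : X →ₗ[ℝ] Y} {T : X →ₗ[ℝ] W}

/-- The cost `E (H x) + lam ‖T x‖` of the inverse problem with data term `E ∘ H` and regularization
operator `T`. It covers both `LSIOperator.cost` and its relaxation to a dual space. -/
def regCost (E : Y → ℝ≥0∞) (lam : ℝ) (H : X →ₗ[ℝ] Y) (T : X →ₗ[ℝ] W) (x : X) : ℝ≥0∞ :=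
  E (H x) + ENNReal.ofReal (lam * ‖T x‖)

/-- The solution set of the inverse problem with cost `regCost E lam H T`. -/
def regMinimizers (E : Y → ℝ≥0∞) (lam : ℝ) (H : X →ₗ[ℝ] Y) (T : X →ₗ[ℝ] W) : Set X :=
  {x | ∀ x', regCost E lam H T x ≤ regCost E lam H T x'}

theorem convexOn_regCost (hE : ConvexOn ℝ≥0 univ E) (hlam : 0 ≤ lam) :
    ConvexOn ℝ≥0 univ (regCost E lam H T) := by
  refine ConvexOn.add (f := E ∘ H) ⟨convex_univ, fun x _ y _ a b ha hb hab => ?_⟩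
    ⟨convex_univ, fun x _ y _ a b _ _ _ => ?_⟩
  · have h := hE.2 (mem_univ (H x)) (mem_univ (H y)) ha hb hab
    simpa only [Function.comp_apply, NNReal.smul_def, map_add, map_smul] using h
  · calc ENNReal.ofReal (lam * ‖T (a • x + b • y)‖)
        ≤ ENNReal.ofReal (a * (lam * ‖T x‖) + b * (lam * ‖T y‖)) := by
          refine ENNReal.ofReal_le_ofReal ?_
          have h : ‖T (a • x + b • y)‖ ≤ a * ‖T x‖ + b * ‖T y‖ := by
            simpa only [NNReal.smul_def, map_add, map_smul, norm_smul, NNReal.norm_eq] using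
              norm_add_le (T ((a : ℝ) • x)) (T ((b : ℝ) • y))
          nlinarith [mul_le_mul_of_nonneg_left h hlam]
      _ = a • ENNReal.ofReal (lam * ‖T x‖) + b • ENNReal.ofReal (lam * ‖T y‖) := by
          rw [ENNReal.ofReal_add (by positivity) (by positivity),
            ENNReal.ofReal_mul a.coe_nonneg, ENNReal.ofReal_mul b.coe_nonneg,
            ENNReal.ofReal_coe_nnreal, ENNReal.ofReal_coe_nnreal]
          rfl

theorem convex_regMinimizers (hE : ConvexOn ℝ≥0 univ E) (hlam : 0 ≤ lam) :
    Convex ℝ (regMinimizers E lam H T) := by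
  have h : regMinimizers E lam H T =
      ⋂ x', {x ∈ univ | regCost E lam H T x ≤ regCost E lam H T x'} := by
    ext x
    simp [regMinimizers]
  rw [h]
  exact convex_iInter fun x' => NNReal.convex_iff.mp ((convexOn_regCost hE hlam).convex_le _)

theorem regCost_ne_top_of_mem_regMinimizers (hfeas : ∃ x, E (H x) ≠ ⊤) {x : X}
    (hx : x ∈ regMinimizers E lam H T) : regCost E lam H T x ≠ ⊤ := by
  obtain ⟨x₀, h₀⟩ := hfeas
  exact ne_top_of_le_ne_top (ENNReal.add_ne_top.mpr ⟨h₀, ENNReal.ofReal_ne_top⟩) (hx x₀)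

theorem norm_le_of_mem_regMinimizers (hlam : 0 < lam) (hfeas : ∃ x, E (H x) ≠ ⊤) {x x' : X}
    (hx : x ∈ regMinimizers E lam H T) (h : H x' = H x) : ‖T x‖ ≤ ‖T x'‖ := by
  have hfin := (ENNReal.add_ne_top.mp (regCost_ne_top_of_mem_regMinimizers hfeas hx)).1
  have hle := hx x'
  rw [regCost, regCost, h, ENNReal.add_le_add_iff_left hfin,
    ENNReal.ofReal_le_ofReal_iff (by positivity)] at hle
  exact le_of_mul_le_mul_left hle hlam

theorem mem_regMinimizers_of_norm_le (hlam : 0 ≤ lam) {x x' : X}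
    (hx : x ∈ regMinimizers E lam H T) (h : H x' = H x) (hle : ‖T x'‖ ≤ ‖T x‖) :
    x' ∈ regMinimizers E lam H T := fun x'' => by
  refine le_trans ?_ (hx x'')
  rw [regCost, regCost, h]
  gcongr

/-- A direction along which the norm is majorized by a linear function would prolong a solution
to a segment of solutions. -/
theorem eq_zero_of_mem_extremePoints_regMinimizers (hlam : 0 < lam) (hfeas : ∃ x, E (H x) ≠ ⊤)
    {x h : X} (hx : x ∈ (regMinimizers E lam H T).extremePoints ℝ) (hh : H h = 0) {c : ℝ}
    (hadd : ‖T (x + h)‖ ≤ ‖T x‖ + c) (hsub : ‖T (x - h)‖ ≤ ‖T x‖ - c) : h = 0 := by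
  have hHadd : H (x + h) = H x := by rw [map_add, hh, add_zero]
  have hHsub : H (x - h) = H x := by rw [map_sub, hh, sub_zero]
  have hge := norm_le_of_mem_regMinimizers hlam hfeas hx.1 hHadd
  have hge' := norm_le_of_mem_regMinimizers hlam hfeas hx.1 hHsub
  have hmem := mem_regMinimizers_of_norm_le hlam.le hx.1 hHadd (by linarith)
  have hmem' := mem_regMinimizers_of_norm_le hlam.le hx.1 hHsub (by linarith)
  have hseg : x ∈ openSegment ℝ (x + h) (x - h) :=
    ⟨1 / 2, 1 / 2, by norm_num, by norm_num, by norm_num, by module⟩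
  exact left_eq_add.mp (hx.2 hmem hmem' hseg).symm

theorem regMinimizers_eq_preimage {H' : X' →ₗ[ℝ] Y} {T' : X' →ₗ[ℝ] W} {J : X → X'}
    (hH : ∀ x, H' (J x) = H x) (hT : ∀ x, T' (J x) = T x)
    (hne : (regMinimizers E lam H' T').Nonempty) (hJ : regMinimizers E lam H' T' ⊆ range J) :
    regMinimizers E lam H T = J ⁻¹' regMinimizers E lam H' T' := by
  have hcost (x : X) : regCost E lam H' T' (J x) = regCost E lam H T x := by
    rw [regCost, regCost, hH, hT]
  obtain ⟨y₀, hy₀⟩ := hne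
  obtain ⟨x₀, rfl⟩ := hJ hy₀
  refine Subset.antisymm (fun x hx y => ?_) fun x hx x' => ?_
  · calc regCost E lam H' T' (J x) ≤ regCost E lam H' T' (J x₀) := by
          simpa only [hcost] using hx x₀
      _ ≤ regCost E lam H' T' y := hy₀ y
  · simpa only [hcost] using hx (J x')

theorem lowerSemicontinuous_regCost [TopologicalSpace X] [TopologicalSpace Y]
    (hE : LowerSemicontinuous E) (hlam : 0 ≤ lam) (hH : Continuous H)
    (hT : LowerSemicontinuous fun x => ‖T x‖) : LowerSemicontinuous (regCost E lam H T) := by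
  have hmono : Monotone fun t : ℝ => ENNReal.ofReal (lam * t) := fun s t hst => by dsimp; gcongr
  exact (hE.comp hH).add (Continuous.comp_lowerSemicontinuous
    (g := fun t : ℝ => ENNReal.ofReal (lam * t))
    (ENNReal.continuous_ofReal.comp (continuous_const_mul lam)) hT hmono)

end RegularizedProblem

section ArgMin

variable {Z : Type*} [TopologicalSpace Z] {C : Z → ℝ≥0∞}

theorem nonempty_argmin_of_isCompact_le (hC : LowerSemicontinuous C)
    (hK : ∀ r ≠ ⊤, IsCompact {z | C z ≤ r}) (hfeas : ∃ z, C z ≠ ⊤) :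
    {z | ∀ z', C z ≤ C z'}.Nonempty := by
  obtain ⟨z₀, h₀⟩ := hfeas
  obtain ⟨z, -, hmin⟩ := LowerSemicontinuousOn.exists_isMinOn (s := {z | C z ≤ C z₀})
    ⟨z₀, le_refl (C z₀)⟩ (hK _ h₀) (hC.lowerSemicontinuousOn _)
  refine ⟨z, fun z' => ?_⟩
  rcases le_total (C z') (C z₀) with h | h
  · exact hmin h
  · exact (hmin (le_refl (C z₀))).trans h

theorem isCompact_argmin_of_isCompact_le (hK : ∀ r ≠ ⊤, IsCompact {z | C z ≤ r})
    (hfeas : ∃ z, C z ≠ ⊤) : IsCompact {z | ∀ z', C z ≤ C z'} := by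
  obtain hs | ⟨z, hz⟩ := {z | ∀ z', C z ≤ C z'}.eq_empty_or_nonempty
  · simp [hs]
  obtain ⟨z₀, h₀⟩ := hfeas
  have h : {z | ∀ z', C z ≤ C z'} = {z' | C z' ≤ C z} :=
    Set.ext fun z' => ⟨fun h => h z, fun h z'' => le_trans h (hz z'')⟩
  rw [h]
  exact hK _ (ne_top_of_le_ne_top h₀ (hz z₀))

end ArgMin

section DualProblem

open scoped Pointwise in
theorem isCompact_preimage_inter_fst_preimage {P F Y : Type*}
    [AddCommGroup P] [Module ℝ P] [TopologicalSpace P] [T2Space P]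
    [AddCommGroup F] [Module ℝ F] [TopologicalSpace F] [IsTopologicalAddGroup F]
    [ContinuousSMul ℝ F] [T2Space F] [FiniteDimensional ℝ F]
    [AddCommGroup Y] [Module ℝ Y] [TopologicalSpace Y] [IsTopologicalAddGroup Y]
    [ContinuousSMul ℝ Y] [T2Space Y]
    {A : P × F →L[ℝ] Y} (hA : ∀ c, A (0, c) = 0 → c = 0) {B : Set P} (hB : IsCompact B)
    {K : Set Y} (hK : IsCompact K) : IsCompact (A ⁻¹' K ∩ Prod.fst ⁻¹' B) := by
  let A₁ : P →L[ℝ] Y := A.comp (ContinuousLinearMap.inl ℝ P F)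
  let A₂ : F →L[ℝ] Y := A.comp (ContinuousLinearMap.inr ℝ P F)
  have hA₂ : IsClosedEmbedding A₂ := LinearMap.isClosedEmbedding_of_injective
    (f := A₂.toLinearMap) (LinearMap.ker_eq_bot'.mpr hA)
  have hD : IsCompact (A₂ ⁻¹' (K - A₁ '' B)) :=
    hA₂.isCompact_preimage (by rw [sub_eq_add_neg]; exact hK.add (hB.image A₁.continuous).neg)
  refine (hB.prod hD).of_isClosed_subset ((hK.isClosed.preimage A.continuous).inter
    (hB.isClosed.preimage continuous_fst)) fun ⟨w, c⟩ ⟨hKy, hBy⟩ => ⟨hBy, ?_⟩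
  refine ⟨A (w, c), hKy, A₁ w, mem_image_of_mem _ hBy, ?_⟩
  simp [A₁, A₂, sub_eq_iff_eq_add, ← map_add]

variable {V F Y : Type*} [NormedAddCommGroup V] [NormedSpace ℝ V]
  [AddCommGroup F] [Module ℝ F] [TopologicalSpace F]
  [AddCommGroup Y] [Module ℝ Y] [TopologicalSpace Y]
  {E : Y → ℝ≥0∞} {lam : ℝ} {A : WeakDual ℝ V × F →L[ℝ] Y}

variable (V F) in
/-- The regularization operator of the relaxed problem: the projection `(w, c) ↦ w`, with values in
the dual space carrying its norm. -/
def dualPart : WeakDual ℝ V × F →ₗ[ℝ] StrongDual ℝ V :=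
  WeakDual.toStrongDual.toLinearMap ∘ₗ LinearMap.fst ℝ (WeakDual ℝ V) F

theorem lowerSemicontinuous_norm_dualPart : LowerSemicontinuous fun y => ‖dualPart V F y‖ := by
  refine LowerSemicontinuous.comp (f := fun w : WeakDual ℝ V => ‖WeakDual.toStrongDual w‖) ?_
    continuous_fst
  rw [lowerSemicontinuous_iff_isClosed_preimage]
  intro r
  convert WeakDual.isClosed_closedBall (𝕜 := ℝ) (E := V) 0 r using 1
  ext w
  simp

theorem isCompact_dual_regCost_le [IsTopologicalAddGroup F] [ContinuousSMul ℝ F] [T2Space F]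
    [FiniteDimensional ℝ F] [IsTopologicalAddGroup Y] [ContinuousSMul ℝ Y] [T2Space Y]
    (hE : LowerSemicontinuous E) (hcoer : Tendsto E (cocompact Y) (𝓝 ⊤)) (hlam : 0 < lam)
    (hA : ∀ c, A (0, c) = 0 → c = 0) {r : ℝ≥0∞} (hr : r ≠ ⊤) :
    IsCompact {y | regCost E lam A.toLinearMap (dualPart V F) y ≤ r} := by
  obtain ⟨K, hK, hKE⟩ : ∃ K : Set Y, IsCompact K ∧ ∀ v, E v ≤ r → v ∈ K := by
    obtain ⟨K, hK, hKE⟩ := mem_cocompact.mp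
      (hcoer.eventually (lt_mem_nhds (lt_top_iff_ne_top.mpr hr)))
    exact ⟨K, hK, fun v hv => by_contra fun hvK => not_lt.mpr hv (hKE hvK)⟩
  have hB := WeakDual.isCompact_closedBall (𝕜 := ℝ) (E := V) 0 (r.toReal / lam)
  refine (isCompact_preimage_inter_fst_preimage hA hB hK).of_isClosed_subset
    ((lowerSemicontinuous_regCost hE hlam.le A.continuous
      lowerSemicontinuous_norm_dualPart).isClosed_preimage r) fun y hy => ⟨?_, ?_⟩
  · exact hKE _ (le_self_add.trans hy)
  · have h : ENNReal.ofReal (lam * ‖dualPart V F y‖) ≤ r := le_add_self.trans hy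
    rw [ENNReal.ofReal_le_iff_le_toReal hr, mul_comm, ← le_div_iff₀ hlam] at h
    simpa [dualPart] using h

theorem exists_norm_le_one_apply_eq_norm [ProperSpace V] (g : StrongDual ℝ V) :
    ∃ η : V, ‖η‖ ≤ 1 ∧ g η = ‖g‖ := by
  obtain ⟨η, hη, hmax⟩ := (isCompact_closedBall (0 : V) 1).exists_isMaxOn ⟨0, by simp⟩
    g.continuous.continuousOn
  have hη1 : ‖η‖ ≤ 1 := by simpa using hη
  have hnonneg : 0 ≤ g η := by simpa using hmax (show (0 : V) ∈ Metric.closedBall 0 1 by simp)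
  refine ⟨η, hη1, le_antisymm ((le_abs_self _).trans (g.unit_le_opNorm η hη1)) ?_⟩
  refine g.opNorm_le_of_unit_norm hnonneg fun x hx => abs_le'.mpr ⟨hmax (by simp [hx]), ?_⟩
  rw [← map_neg]
  exact hmax (by simp [hx])

/-- By Hahn–Banach, the minimal norm is already attained on the span of the constraints. -/
theorem exists_apply_eq_norm_of_norm_le {ι : Type*} [Finite ι] {w₀ : StrongDual ℝ V} (v : ι → V)
    (h : ∀ w : StrongDual ℝ V, (∀ i, w (v i) = w₀ (v i)) → ‖w₀‖ ≤ ‖w‖) :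
    ∃ η : V, ‖η‖ ≤ 1 ∧ w₀ η = ‖w₀‖ := by
  let S : Submodule ℝ V := Submodule.span ℝ (range v)
  have : FiniteDimensional ℝ S := FiniteDimensional.span_of_finite ℝ (finite_range v)
  have : ProperSpace S := FiniteDimensional.proper ℝ S
  obtain ⟨w, hw, hnorm⟩ := exists_extension_norm_eq S (w₀.comp S.subtypeL)
  obtain ⟨η, hη, hη'⟩ := exists_norm_le_one_apply_eq_norm (w₀.comp S.subtypeL)
  have hle : ‖w₀‖ ≤ ‖w‖ := h w fun i => hw ⟨v i, Submodule.subset_span ⟨i, rfl⟩⟩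
  refine ⟨η, hη, le_antisymm ((le_abs_self _).trans (w₀.unit_le_opNorm _ hη)) ?_⟩
  calc ‖w₀‖ ≤ ‖w‖ := hle
    _ = w₀ η := by rw [hnorm, ← hη']; rfl

theorem exists_eq_eval (g : WeakDual ℝ V →L[ℝ] ℝ) :
    ∃ ψ : V, ∀ w : WeakDual ℝ V, g w = w ψ := by
  obtain ⟨ψ, rfl⟩ := LinearMap.dualEmbedding_surjective (topDualPairing ℝ V) g
  exact ⟨ψ, fun _ => rfl⟩

theorem exists_apply_eq_norm_of_mem_dual_regMinimizers {ι : Type*} [Finite ι]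
    {E : (ι → ℝ) → ℝ≥0∞} {A : WeakDual ℝ V × F →L[ℝ] (ι → ℝ)} (hlam : 0 < lam)
    (hfeas : ∃ y, E (A y) ≠ ⊤) {y : WeakDual ℝ V × F}
    (hy : y ∈ regMinimizers E lam A.toLinearMap (dualPart V F)) :
    ∃ η : V, ‖η‖ ≤ 1 ∧ dualPart V F y η = ‖dualPart V F y‖ := by
  choose ψ hψ using fun i : ι => exists_eq_eval
    ((ContinuousLinearMap.proj i).comp (A.comp (ContinuousLinearMap.inl ℝ (WeakDual ℝ V) F)))
  refine exists_apply_eq_norm_of_norm_le ψ fun w hw => ?_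
  have hsplit (u : WeakDual ℝ V) (c : F) : A (u, c) = A (u, 0) + A (0, c) := by
    rw [← map_add, Prod.mk_add_mk, add_zero, zero_add]
  have hA : A (StrongDual.toWeakDual w, y.2) = A (y.1, y.2) := by
    rw [hsplit, hsplit y.1]
    congr 1
    ext i
    calc A (StrongDual.toWeakDual w, 0) i = w (ψ i) := hψ i (StrongDual.toWeakDual w)
      _ = y.1 (ψ i) := hw i
      _ = A (y.1, 0) i := (hψ i y.1).symm
  exact norm_le_of_mem_regMinimizers (T := dualPart V F) (x' := (StrongDual.toWeakDual w, y.2))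
    hlam hfeas hy hA

end DualProblem

section InducedTopology

variable {X Z : Type*} [AddCommGroup X] [Module ℝ X] [AddCommGroup Z] [Module ℝ Z]

theorem exists_comp_eq_of_continuous_induced [t : TopologicalSpace Z] {I : Type*}
    {F : I → Z →L[ℝ] ℝ} (hF : IsInducing fun z i => F i z) (J : X →ₗ[ℝ] Z) {g : X →ₗ[ℝ] ℝ}
    (hg : Continuous[t.induced J, inferInstance] g) : ∃ G : Z →L[ℝ] ℝ, ∀ x, G (J x) = g x := by
  have hspan : g ∈ Submodule.span ℝ (range fun i => (F i).toLinearMap ∘ₗ J) := by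
    rw [LinearMap.mem_span_iff_continuous]
    have htop : t.induced J =
        ⨅ i, TopologicalSpace.induced ((F i).toLinearMap ∘ₗ J) inferInstance :=
      (congrArg (TopologicalSpace.induced J) hF.eq_induced).trans
        (induced_compose.trans (induced_to_pi _))
    rwa [← htop]
  let comp : (Z →L[ℝ] ℝ) →ₗ[ℝ] X →ₗ[ℝ] ℝ := LinearMap.lcomp ℝ ℝ J ∘ₗ ContinuousLinearMap.coeLM ℝ
  have hrange : range (fun i => (F i).toLinearMap ∘ₗ J) = comp '' range F := (range_comp comp F)
  rw [hrange, Submodule.span_image] at hspan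
  obtain ⟨G, -, rfl⟩ := hspan
  exact ⟨G, fun _ => rfl⟩

theorem closure_convexHull_extremePoints_induced [t : TopologicalSpace Z]
    [IsTopologicalAddGroup Z] [ContinuousSMul ℝ Z] [LocallyConvexSpace ℝ Z] [T2Space Z]
    {J : X →ₗ[ℝ] Z} (hJ : Function.Injective J) {s : Set X} (hs : @IsCompact X (t.induced J) s)
    (hc : Convex ℝ s) : closure[t.induced J] (convexHull ℝ (s.extremePoints ℝ)) = s := by
  let _ : TopologicalSpace X := t.induced J
  have : IsTopologicalAddGroup X := topologicalAddGroup_induced J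
  have : ContinuousSMul ℝ X := continuousSMul_induced J.toMulActionHom
  have : LocallyConvexSpace ℝ X := LocallyConvexSpace.induced J
  have : T2Space X := T2Space.of_injective_continuous hJ continuous_induced_dom
  exact closure_convexHull_extremePoints hs hc

end InducedTopology

section WeakStar

variable {X V ι : Type*} [AddCommGroup X] [Module ℝ X] [NormedAddCommGroup V] [NormedSpace ℝ V]
  {T : X →ₗ[ℝ] StrongDual ℝ V} {φ : ι → X →ₗ[ℝ] ℝ}

instance : LocallyConvexSpace ℝ (WeakDual ℝ V) :=
  WeakBilin.locallyConvexSpace (B := topDualPairing ℝ V)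

variable (V ι) in
theorem exists_isInducing_weakDual_prod :
    ∃ F : V ⊕ ι → WeakDual ℝ V × (ι → ℝ) →L[ℝ] ℝ, IsInducing fun z i => F i z := by
  have hV : IsInducing fun (w : WeakDual ℝ V) (ψ : V) => w ψ := ⟨rfl⟩
  let ev (ψ : V) : WeakDual ℝ V →L[ℝ] ℝ := WeakBilin.eval (topDualPairing ℝ V) ψ
  refine ⟨Sum.elim (fun ψ => (ev ψ).comp (ContinuousLinearMap.fst ℝ (WeakDual ℝ V) (ι → ℝ)))
    fun n => (ContinuousLinearMap.proj n).comp
      (ContinuousLinearMap.snd ℝ (WeakDual ℝ V) (ι → ℝ)), ?_⟩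
  convert (Homeomorph.sumArrowHomeomorphProdArrow (ι := V) (ι' := ι) (X := ℝ)).symm.isInducing.comp
    (hV.prodMap (IsInducing.id (X := ι → ℝ))) using 1
  ext z (ψ | n) <;> rfl

/-- The map `x ↦ (T x, (φ n x)_n)`, which realizes `X` with its weak* topology as a subspace of a
dual space. -/
def embed (T : X →ₗ[ℝ] StrongDual ℝ V) (φ : ι → X →ₗ[ℝ] ℝ) : X →ₗ[ℝ] WeakDual ℝ V × (ι → ℝ) :=
  (StrongDual.toWeakDual.toLinearMap ∘ₗ T).prod (LinearMap.pi φ)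

theorem exists_comp_embed_eq {κ : Type*} {H : X →ₗ[ℝ] κ → ℝ}
    (hH : Continuous[TopologicalSpace.induced (embed T φ) inferInstance, inferInstance] H) :
    ∃ A : WeakDual ℝ V × (ι → ℝ) →L[ℝ] (κ → ℝ), ∀ x, A (embed T φ x) = H x := by
  let _ : TopologicalSpace X := TopologicalSpace.induced (embed T φ) inferInstance
  obtain ⟨F, hF⟩ := exists_isInducing_weakDual_prod V ι
  choose A hA using fun i => exists_comp_eq_of_continuous_induced hF (embed T φ)
    (g := LinearMap.proj i ∘ₗ H) ((continuous_apply i).comp hH)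
  exact ⟨ContinuousLinearMap.pi A, fun x => funext fun i => hA i x⟩

variable [DecidableEq ι] {p : Module.Basis ι ℝ (LinearMap.ker T)}

theorem apply_eq_repr (hφ : ∀ m n, φ m (p n) = if m = n then 1 else 0) (q : LinearMap.ker T)
    (m : ι) : φ m q = p.repr q m := by
  have h : φ m ∘ₗ (LinearMap.ker T).subtype = p.coord m := p.ext fun n => by
    simp [hφ, Finsupp.single_apply, eq_comm]
  exact LinearMap.congr_fun h q

theorem embed_injective (hφ : ∀ m n, φ m (p n) = if m = n then 1 else 0) :
    Function.Injective (embed T φ) := by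
  refine (injective_iff_map_eq_zero _).mpr fun x hx => ?_
  have hTx : T x = 0 := congrArg Prod.fst hx
  have hrepr : p.repr ⟨x, hTx⟩ = 0 := by
    ext m
    rw [← apply_eq_repr hφ]
    exact congrFun (congrArg Prod.snd hx) m
  exact congrArg Subtype.val (p.repr.map_eq_zero_iff.mp hrepr)

theorem range_embed [Finite ι] (hφ : ∀ m n, φ m (p n) = if m = n then 1 else 0) :
    range (embed T φ) = dualPart V (ι → ℝ) ⁻¹' range T := by
  refine Subset.antisymm ?_ ?_
  · rintro _ ⟨x, rfl⟩
    exact ⟨x, rfl⟩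
  · rintro ⟨w, c⟩ ⟨x, hx⟩
    let q : LinearMap.ker T := p.equivFun.symm fun m => c m - φ m x
    have hq (m : ι) : φ m q = c m - φ m x := by
      rw [apply_eq_repr hφ, ← p.equivFun_apply, p.equivFun.apply_symm_apply]
    refine ⟨x + q, Prod.ext ?_ (funext fun m => ?_)⟩
    · change T (x + q) = _
      rw [map_add, q.2, add_zero]
      exact hx
    · change φ m (x + q) = c m
      rw [map_add, hq, add_sub_cancel]

theorem eq_zero_of_apply_inr_eq_zero [Finite ι] {Y : Type*} [AddCommGroup Y] [Module ℝ Y]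
    [TopologicalSpace Y] {H : X →ₗ[ℝ] Y} {A : WeakDual ℝ V × (ι → ℝ) →L[ℝ] Y}
    (hφ : ∀ m n, φ m (p n) = if m = n then 1 else 0) (hA : ∀ x, A (embed T φ x) = H x)
    (hker : ∀ q ∈ LinearMap.ker T, H q = 0 → q = 0) (c : ι → ℝ) (hc : A (0, c) = 0) : c = 0 := by
  obtain ⟨q, hq⟩ : (0, c) ∈ range (embed T φ) := by
    rw [range_embed hφ]
    exact ⟨0, map_zero T⟩
  have hq0 : q = 0 := hker q (congrArg Prod.fst hq) (by rw [← hA, hq, hc])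
  rw [hq0, map_zero] at hq
  exact (congrArg Prod.snd hq).symm

end WeakStar

section ZeroAtInfty

variable {Ω : Type*} [TopologicalSpace Ω]

theorem abs_apply_le_norm (g : C₀(Ω, ℝ)) (x : Ω) : |g x| ≤ ‖g‖ := by
  rw [← ZeroAtInftyContinuousMap.norm_toBCF_eq_norm]
  exact g.toBCF.norm_coe_le_norm x

theorem norm_le_of_forall_abs_le {g : C₀(Ω, ℝ)} {C : ℝ} (hC : 0 ≤ C) (h : ∀ x, |g x| ≤ C) :
    ‖g‖ ≤ C := by
  rw [← ZeroAtInftyContinuousMap.norm_toBCF_eq_norm]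
  exact (BoundedContinuousFunction.norm_le hC).mpr h

theorem isCompact_le_abs (g : C₀(Ω, ℝ)) {c : ℝ} (hc : 0 < c) : IsCompact {x | c ≤ |g x|} := by
  have hsmall : ∀ᶠ x in cocompact Ω, |g x| < c := by
    simpa using (zero_at_infty g).abs.eventually_lt_const (by simpa using hc)
  obtain ⟨K, hK, hKg⟩ := mem_cocompact.mp hsmall
  refine hK.of_isClosed_subset (isClosed_le continuous_const g.continuous.abs)
    fun x (hx : c ≤ |g x|) => ?_
  exact by_contra fun hxK => (hKg hxK).not_ge hx

variable {w : StrongDual ℝ C₀(Ω, ℝ)} {η g : C₀(Ω, ℝ)}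

theorem apply_nonpos_of_abs_add_le_one (hw : w η = ‖w‖) (h : ∀ x, |η x + g x| ≤ 1) :
    w g ≤ 0 := by
  have hle : w (η + g) ≤ ‖w‖ :=
    (le_abs_self _).trans (w.unit_le_opNorm _ (norm_le_of_forall_abs_le zero_le_one h))
  rw [map_add, hw] at hle
  linarith

theorem apply_eq_zero_of_abs_le (hw : w η = ‖w‖) {C : ℝ} (hC : 0 < C)
    (hg : ∀ x, |g x| ≤ C * (1 - |η x|)) : w g = 0 := by
  have hfit : ∀ s : ℝ, |s| = C⁻¹ → ∀ x, |η x + s * g x| ≤ 1 := fun s hs x => by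
    have : |s * g x| ≤ 1 - |η x| := by
      rw [abs_mul, hs, inv_mul_le_iff₀ hC]
      exact hg x
    linarith [abs_add_le (η x) (s * g x)]
  have hC' : 0 < C⁻¹ := inv_pos.mpr hC
  have hle : w (C⁻¹ • g) ≤ 0 := apply_nonpos_of_abs_add_le_one hw (hfit _ (abs_of_pos hC'))
  have hge : w ((-C⁻¹) • g) ≤ 0 :=
    apply_nonpos_of_abs_add_le_one hw (hfit _ (by rw [abs_neg, abs_of_pos hC']))
  simp only [map_smul, smul_eq_mul] at hle hge
  nlinarith

theorem apply_mul_nonneg (hη : ‖η‖ ≤ 1) (hw : w η = ‖w‖) (hg : ∀ x, 0 ≤ g x) :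
    0 ≤ w (η * g) := by
  have hc : 0 < ‖g‖ + 1 := by positivity
  have h : w (-((‖g‖ + 1)⁻¹ • (η * g))) ≤ 0 := by
    refine apply_nonpos_of_abs_add_le_one hw fun x => ?_
    have hfactor : η x + (-((‖g‖ + 1)⁻¹ • (η * g))) x = η x * (1 - (‖g‖ + 1)⁻¹ * g x) := by
      simp
      ring
    have hle : (‖g‖ + 1)⁻¹ * g x ≤ 1 := by
      rw [inv_mul_le_one₀ hc]
      linarith [(le_abs_self _).trans (abs_apply_le_norm g x)]
    have hnonneg : 0 ≤ (‖g‖ + 1)⁻¹ * g x := mul_nonneg (by positivity) (hg x)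
    rw [hfactor, abs_mul]
    refine mul_le_one₀ ((abs_apply_le_norm η x).trans hη) (abs_nonneg _) ?_
    rw [abs_le]
    constructor <;> linarith
  rw [map_neg, map_smul, smul_eq_mul, neg_nonpos] at h
  exact nonneg_of_mul_nonneg_right h (by positivity)

theorem apply_mul_mul_self (hη : ‖η‖ ≤ 1) (hw : w η = ‖w‖) (g : C₀(Ω, ℝ)) :
    w (η * (η * g)) = w g := by
  refine (sub_eq_zero.mp ?_).symm
  rw [← map_sub]
  refine apply_eq_zero_of_abs_le hw (C := 2 * (‖g‖ + 1)) (by positivity) fun x => ?_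
  have hηx : |η x| ≤ 1 := (abs_apply_le_norm η x).trans hη
  have hfactor : (g - η * (η * g)) x = (1 - |η x|) * ((1 + |η x|) * g x) := by
    simp only [ZeroAtInftyContinuousMap.sub_apply, ZeroAtInftyContinuousMap.mul_apply]
    linear_combination g x * sq_abs (η x)
  rw [hfactor, abs_mul, abs_mul, abs_of_nonneg (sub_nonneg.mpr hηx),
    abs_of_nonneg (by positivity : 0 ≤ 1 + |η x|), mul_comm]
  refine mul_le_mul_of_nonneg_right ?_ (sub_nonneg.mpr hηx)
  have hgx : |g x| ≤ ‖g‖ + 1 := by linarith [abs_apply_le_norm g x]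
  exact mul_le_mul (by linarith) hgx (abs_nonneg _) zero_le_two

theorem exists_hasCompactSupport_apply_eq [LocallyCompactSpace Ω] [T2Space Ω]
    (hη : ‖η‖ ≤ 1) (hw : w η = ‖w‖) (g : C₀(Ω, ℝ)) :
    ∃ f : C₀(Ω, ℝ), HasCompactSupport f ∧ w f = w g ∧ ∀ x, |η x| = 1 → f x = g x := by
  have hS : IsCompact {x | 1 / 2 ≤ |η x|} := isCompact_le_abs η one_half_pos
  obtain ⟨u, hu1, -, hu, hu01⟩ :=
    exists_continuous_one_zero_of_isCompact hS isClosed_empty (disjoint_empty _)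
  have huS : ∀ x, 1 / 2 ≤ |η x| → u x = 1 := fun x hx => hu1 hx
  let U : C₀(Ω, ℝ) := ⟨u, hu.is_zero_at_infty⟩
  refine ⟨U * g, hu.mul_right, ?_, fun x hx => ?_⟩
  · rw [← sub_eq_zero, ← map_sub]
    refine apply_eq_zero_of_abs_le hw (C := 2 * (‖g‖ + 1)) (by positivity) fun x => ?_
    have hηx : |η x| ≤ 1 := (abs_apply_le_norm η x).trans hη
    have hfactor : (U * g - g) x = (u x - 1) * g x := by
      change u x * g x - g x = _
      ring
    rw [hfactor, abs_mul]
    by_cases hx : 1 / 2 ≤ |η x|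
    · rw [huS x hx, sub_self, abs_zero, zero_mul]
      exact mul_nonneg (by positivity) (sub_nonneg.mpr hηx)
    · have hu1 : |u x - 1| ≤ 1 := abs_le.mpr ⟨by linarith [(hu01 x).1], by linarith [(hu01 x).2]⟩
      have hgx := abs_apply_le_norm g x
      nlinarith [mul_le_mul hu1 hgx (abs_nonneg _) zero_le_one, norm_nonneg g]
  · change u x * g x = g x
    rw [huS x (by rw [hx]; norm_num), one_mul]

end ZeroAtInfty

section Density

variable {Ω : Type*} [TopologicalSpace Ω] [MeasurableSpace Ω] [OpensMeasurableSpace Ω]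
  (μ : Measure Ω) [IsFiniteMeasure μ]

theorem integrable_zeroAtInfty (g : C₀(Ω, ℝ)) : Integrable g μ :=
  Integrable.of_bound g.continuous.aestronglyMeasurable ‖g‖
    (Eventually.of_forall fun x => abs_apply_le_norm g x)

/-- Integration against the finite measure `μ`, as an element of `C₀(Ω)'`. -/
def integralCLM : StrongDual ℝ C₀(Ω, ℝ) :=
  LinearMap.mkContinuous
    { toFun := fun g => ∫ x, g x ∂μ
      map_add' := fun g h =>
        integral_add (integrable_zeroAtInfty μ g) (integrable_zeroAtInfty μ h)
      map_smul' := fun c g => integral_const_mul c g }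
    (μ.real univ) fun g => (norm_integral_le_of_norm_le_const
      (Eventually.of_forall fun x => abs_apply_le_norm g x)).trans_eq (mul_comm _ _)

/-- The element `θ μ` of `C₀(Ω)'` with density `θ` with respect to `μ`. -/
def density : C₀(Ω, ℝ) →L[ℝ] StrongDual ℝ C₀(Ω, ℝ) :=
  (ContinuousLinearMap.compL ℝ _ _ ℝ (integralCLM μ)).comp (ContinuousLinearMap.mul ℝ C₀(Ω, ℝ))

theorem density_apply (θ g : C₀(Ω, ℝ)) : density μ θ g = ∫ x, θ x * g x ∂μ := rfl

theorem norm_density_le (θ : C₀(Ω, ℝ)) : ‖density μ θ‖ ≤ ∫ x, |θ x| ∂μ := by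
  refine ContinuousLinearMap.opNorm_le_bound _ (integral_nonneg fun x => abs_nonneg _) fun g => ?_
  rw [density_apply, ← integral_mul_const]
  refine norm_integral_le_of_norm_le ((integrable_zeroAtInfty μ θ).abs.mul_const _)
    (Eventually.of_forall fun x => ?_)
  rw [norm_mul]
  exact mul_le_mul_of_nonneg_left (abs_apply_le_norm g x) (abs_nonneg _)

end Density

section Polar

variable {Ω : Type*} [TopologicalSpace Ω] [MeasurableSpace Ω] [BorelSpace Ω]

/-- `w = η μ` is a polar decomposition of `w ∈ C₀(Ω)'` with a continuous sign: `|η| ≤ 1` everywhere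
and `|η| = 1` almost everywhere for `μ`. -/
structure IsPolar (w : StrongDual ℝ C₀(Ω, ℝ)) (η : C₀(Ω, ℝ)) (μ : Measure Ω)
    [IsFiniteMeasure μ] : Prop where
  norm_le_one : ‖η‖ ≤ 1
  ae_abs_eq_one : ∀ᵐ x ∂μ, |η x| = 1
  eq_density : w = density μ η

namespace IsPolar

variable {w : StrongDual ℝ C₀(Ω, ℝ)} {η : C₀(Ω, ℝ)} {μ : Measure Ω} [IsFiniteMeasure μ]

theorem abs_apply_le_one (h : IsPolar w η μ) (x : Ω) : |η x| ≤ 1 :=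
  (abs_apply_le_norm η x).trans h.norm_le_one

theorem exists_isCompact_ae_mem (h : IsPolar w η μ) : ∃ K, IsCompact K ∧ ∀ᵐ x ∂μ, x ∈ K :=
  ⟨_, isCompact_le_abs η one_pos, h.ae_abs_eq_one.mono fun _ hx => hx.ge⟩

theorem apply_self (h : IsPolar w η μ) : w η = μ.real univ := by
  have hsq : ∀ᵐ x ∂μ, η x * η x = 1 := h.ae_abs_eq_one.mono fun x hx => by
    rw [← abs_mul_abs_self, hx, one_mul]
  rw [h.eq_density, density_apply, integral_congr_ae hsq]
  simp

/-- The factor `1 + τ` is nonnegative, so `‖η (1 + τ) μ‖` is at most `∫ (1 + τ) dμ`. -/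
theorem norm_add_density_le (h : IsPolar w η μ) {τ : C₀(Ω, ℝ)} (hτ : ‖τ‖ ≤ 1) :
    ‖w + density μ (η * τ)‖ ≤ μ.real univ + ∫ x, τ x ∂μ := by
  have hint : Integrable (fun x => 1 + τ x) μ :=
    (integrable_const 1).add (integrable_zeroAtInfty μ τ)
  rw [h.eq_density, ← map_add]
  refine (norm_density_le μ _).trans ?_
  calc ∫ x, |(η + η * τ) x| ∂μ ≤ ∫ x, (1 + τ x) ∂μ := by
        refine integral_mono (integrable_zeroAtInfty μ _).abs hint fun x => ?_
        have hpos : 0 ≤ 1 + τ x := by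
          linarith [(abs_le.mp ((abs_apply_le_norm τ x).trans hτ)).1]
        change |η x + η x * τ x| ≤ 1 + τ x
        rw [← mul_one_add, abs_mul, abs_of_nonneg hpos]
        exact mul_le_of_le_one_left hpos (h.abs_apply_le_one x)
    _ = μ.real univ + ∫ x, τ x ∂μ := by
        rw [integral_add (integrable_const 1) (integrable_zeroAtInfty μ τ)]
        simp

theorem norm_eq (h : IsPolar w η μ) : ‖w‖ = μ.real univ := by
  refine le_antisymm ?_ ?_
  · simpa using h.norm_add_density_le (τ := 0) (by simp)
  · rw [← h.apply_self]
    exact (le_abs_self _).trans (w.unit_le_opNorm η h.norm_le_one)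

theorem exists_eq_sum [T1Space Ω] (h : IsPolar w η μ) {ι : Type*} [Fintype ι] {x : ι → Ω}
    (hx : Function.Injective x) (hμ : ∀ᵐ y ∂μ, y ∈ range x) :
    ∃ a : ι → ℝ, (∀ g, w g = ∑ k, a k * g (x k)) ∧ ‖w‖ = ∑ k, |a k| := by
  classical
  have hsum : ∀ g : Ω → ℝ, ∫ y, g y ∂μ = ∑ k, μ.real {x k} * g (x k) := fun g => by
    have hrestrict : μ.restrict (Finset.univ.image x : Finset Ω) = μ :=
      Measure.restrict_eq_self_of_ae_mem (by simpa using hμ)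
    conv_lhs => rw [← hrestrict]
    rw [setIntegral_finset _ IntegrableOn.finset, Finset.sum_image hx.injOn]
    rfl
  have hatom : ∀ k, μ.real {x k} * |η (x k)| = μ.real {x k} := fun k => by
    by_cases hη : |η (x k)| = 1
    · rw [hη, mul_one]
    · have : μ {x k} = 0 :=
        measure_mono_null (singleton_subset_iff.mpr hη) h.ae_abs_eq_one
      simp [measureReal_def, this]
  refine ⟨fun k => μ.real {x k} * η (x k), fun g => ?_, ?_⟩
  · simp only [h.eq_density, density_apply, hsum, mul_assoc]
  · calc ‖w‖ = ∫ _, (1 : ℝ) ∂μ := by simp [h.norm_eq]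
      _ = ∑ k, μ.real {x k} * 1 := hsum _
      _ = ∑ k, |μ.real {x k} * η (x k)| := Finset.sum_congr rfl fun k _ => by
          rw [abs_mul, abs_of_nonneg measureReal_nonneg, hatom, mul_one]

end IsPolar

variable [LocallyCompactSpace Ω] [T2Space Ω] {w : StrongDual ℝ C₀(Ω, ℝ)} {η : C₀(Ω, ℝ)}

open scoped CompactlySupported

/-- The positive functional `g ↦ w (η g)`, for a functional `w` that attains its norm at `η`. -/
def polarFunctional (hη : ‖η‖ ≤ 1) (hw : w η = ‖w‖) : C_c(Ω, ℝ) →ₚ[ℝ] ℝ :=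
  PositiveLinearMap.mk₀
    { toFun := fun g => w (η * (g : C₀(Ω, ℝ)))
      map_add' := fun g h => by
        rw [← map_add, ← mul_add]
        rfl
      map_smul' := fun c g => by
        rw [RingHom.id_apply, ← map_smul, ← mul_smul_comm]
        rfl }
    fun _ hg => apply_mul_nonneg hη hw hg

/-- The measure `|w|` of the polar decomposition `w = η |w|`. -/
def polarMeasure (hη : ‖η‖ ≤ 1) (hw : w η = ‖w‖) : Measure Ω :=
  RealRMK.rieszMeasure (polarFunctional hη hw)

instance (hη : ‖η‖ ≤ 1) (hw : w η = ‖w‖) : (polarMeasure hη hw).Regular :=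
  RealRMK.regular_rieszMeasure _

theorem integral_polarMeasure (hη : ‖η‖ ≤ 1) (hw : w η = ‖w‖) {g : C₀(Ω, ℝ)}
    (hg : HasCompactSupport g) : ∫ x, g x ∂polarMeasure hη hw = w (η * g) :=
  RealRMK.integral_rieszMeasure (polarFunctional hη hw) ⟨g, hg⟩

theorem polarMeasure_eq_zero_of_isCompact (hη : ‖η‖ ≤ 1) (hw : w η = ‖w‖) {K : Set Ω}
    (hK : IsCompact K) (hKη : ∀ x ∈ K, |η x| < 1) : polarMeasure hη hw K = 0 := by
  obtain ⟨f, hfK, -, hf, hf01⟩ :=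
    exists_continuous_one_zero_of_isCompact hK isClosed_empty (disjoint_empty _)
  let F : C₀(Ω, ℝ) := ⟨f, hf.is_zero_at_infty⟩
  let G : C₀(Ω, ℝ) := F - η * (η * F)
  have hG : HasCompactSupport G := hf.sub hf.mul_left.mul_left
  have hGx : ∀ x, G x = f x * (1 - |η x| ^ 2) := fun x => by
    change f x - η x * (η x * f x) = _
    rw [sq_abs]
    ring
  have hG0 : 0 ≤ ⇑G := fun x => by
    rw [hGx]
    exact mul_nonneg (hf01 x).1 (sub_nonneg.mpr
      (pow_le_one₀ (abs_nonneg _) ((abs_apply_le_norm η x).trans hη)))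
  have hint : ∫ x, G x ∂polarMeasure hη hw = 0 := by
    rw [integral_polarMeasure hη hw hG, mul_sub, map_sub, apply_mul_mul_self hη hw, sub_self]
  have hae : ∀ᵐ x ∂polarMeasure hη hw, G x = 0 :=
    (integral_eq_zero_iff_of_nonneg hG0
      ((map_continuous G).integrable_of_hasCompactSupport hG)).mp hint
  refine measure_mono_null (t := {x | ¬G x = 0}) (fun x hx hGx0 => ?_) hae
  have hlt : |η x| ^ 2 < 1 := pow_lt_one₀ (abs_nonneg _) (hKη x hx) two_ne_zero
  rw [hGx, hfK hx, Pi.one_apply, one_mul] at hGx0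
  linarith

theorem ae_polarMeasure_abs_eq_one (hη : ‖η‖ ≤ 1) (hw : w η = ‖w‖) :
    ∀ᵐ x ∂polarMeasure hη hw, |η x| = 1 := by
  have hopen : IsOpen {x | |η x| < 1} := isOpen_lt η.continuous.abs continuous_const
  have hnull : polarMeasure hη hw {x | |η x| < 1} = 0 := by
    rw [hopen.measure_eq_iSup_isCompact]
    exact ENNReal.iSup_eq_zero.mpr fun K => ENNReal.iSup_eq_zero.mpr fun hKη =>
      ENNReal.iSup_eq_zero.mpr fun hK => polarMeasure_eq_zero_of_isCompact hη hw hK hKη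
  refine measure_mono_null (fun x hx => ?_) hnull
  exact ((abs_apply_le_norm η x).trans hη).lt_of_ne hx

theorem exists_isPolar (hη : ‖η‖ ≤ 1) (hw : w η = ‖w‖) :
    ∃ (μ : Measure Ω) (_ : IsFiniteMeasure μ), IsPolar w η μ := by
  have hae := ae_polarMeasure_abs_eq_one hη hw
  have hfin : IsFiniteMeasure (polarMeasure hη hw) := by
    refine ⟨?_⟩
    rw [← measure_eq_measure_of_null_sdiff (subset_univ {x | 1 ≤ |η x|})
      (measure_mono_null (fun x hx (h : |η x| = 1) => hx.2 h.ge) hae)]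
    exact (isCompact_le_abs η one_pos).measure_lt_top
  refine ⟨polarMeasure hη hw, hfin, hη, hae, ?_⟩
  ext g
  obtain ⟨f, hf, hwf, hfg⟩ := exists_hasCompactSupport_apply_eq hη hw g
  calc w g = w (η * (η * f)) := by rw [apply_mul_mul_self hη hw, hwf]
    _ = ∫ x, (η * f) x ∂polarMeasure hη hw :=
        (integral_polarMeasure hη hw (hf.mul_left : HasCompactSupport (η * f))).symm
    _ = ∫ x, η x * g x ∂polarMeasure hη hw :=
        integral_congr_ae (hae.mono fun x hx => congrArg (η x * ·) (hfg x hx))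

end Polar

section Dimension

variable {X Y W : Type*} [AddCommGroup X] [Module ℝ X] [AddCommGroup Y] [Module ℝ Y]
  [AddCommGroup W] [Module ℝ W]

theorem finite_and_finrank_add_finrank_ker_le [Module.Finite ℝ Y]
    (H : X →ₗ[ℝ] Y) (T : X →ₗ[ℝ] W) {R : Submodule ℝ W} (hR : R ≤ LinearMap.range T)
    (hinj : ∀ h, T h ∈ R → H h = 0 → h = 0) :
    Module.Finite ℝ R ∧
      Module.finrank ℝ R + Module.finrank ℝ (LinearMap.ker T) ≤ Module.finrank ℝ Y := by
  have hHinj : Function.Injective (H.domRestrict (R.comap T)) :=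
    (injective_iff_map_eq_zero _).mpr fun h hh => Subtype.ext (hinj h h.2 hh)
  have : Module.Finite ℝ (R.comap T) := Module.Finite.of_injective _ hHinj
  let S : R.comap T →ₗ[ℝ] R := T.restrict fun _ h => h
  have hS : Function.Surjective S := fun ⟨v, hv⟩ => by
    obtain ⟨h, rfl⟩ := hR hv
    exact ⟨⟨h, hv⟩, rfl⟩
  have hker : LinearMap.ker T ≤ R.comap T := fun h hh => by
    rw [Submodule.mem_comap, LinearMap.mem_ker.mp hh]
    exact R.zero_mem
  have hkerS : LinearMap.ker T ≃ₗ[ℝ] LinearMap.ker S :=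
    (Submodule.comapSubtypeEquivOfLe hker).symm.trans
      (LinearEquiv.ofEq _ _ (LinearMap.ker_restrict _).symm)
  refine ⟨Module.Finite.of_surjective S hS, ?_⟩
  calc Module.finrank ℝ R + Module.finrank ℝ (LinearMap.ker T)
      = Module.finrank ℝ (R.comap T) := by
        rw [hkerS.finrank_eq, ← S.finrank_range_add_finrank_ker,
          LinearMap.range_eq_top.mpr hS, finrank_top]
    _ ≤ Module.finrank ℝ Y := LinearMap.finrank_le_finrank_of_injective hHinj

theorem finrank_add_finrank_ker_le_of_surjective {V Z : Type*} [AddCommGroup V] [Module ℝ V]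
    [AddCommGroup Z] [Module ℝ Z] [Module.Finite ℝ Y] (H : X →ₗ[ℝ] Y) (T : X →ₗ[ℝ] W)
    (D : V →ₗ[ℝ] W) (e : V →ₗ[ℝ] Z) (hD : LinearMap.range D ≤ LinearMap.range T)
    (hinj : ∀ h, T h ∈ LinearMap.range D → H h = 0 → h = 0) (he : Function.Surjective e)
    (hker : LinearMap.ker D ≤ LinearMap.ker e) :
    Module.finrank ℝ Z + Module.finrank ℝ (LinearMap.ker T) ≤ Module.finrank ℝ Y := by
  obtain ⟨hfin, hrank⟩ := finite_and_finrank_add_finrank_ker_le H T hD hinj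
  have : Module.Finite ℝ (V ⧸ LinearMap.ker D) := Module.Finite.equiv D.quotKerEquivRange.symm
  have hquot : Function.Surjective ((LinearMap.ker D).liftQ e hker) := by
    rw [← LinearMap.range_eq_top, Submodule.range_liftQ, LinearMap.range_eq_top.mpr he]
  have hZ := LinearMap.finrank_le_finrank_of_surjective hquot
  rw [D.quotKerEquivRange.finrank_eq] at hZ
  omega

end Dimension

section Sparsity

variable {Ω : Type*} [TopologicalSpace Ω]

/-- The restriction of functions in `C₀(Ω)` to a finite set. -/
def evalFinset (s : Finset Ω) : C₀(Ω, ℝ) →ₗ[ℝ] (s → ℝ) where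
  toFun g x := g x
  map_add' _ _ := rfl
  map_smul' _ _ := rfl

theorem evalFinset_surjective [LocallyCompactSpace Ω] [T2Space Ω] (s : Finset Ω) :
    Function.Surjective (evalFinset s) := by
  classical
  have hsingle : ∀ k, Pi.single k 1 ∈ LinearMap.range (evalFinset s) := fun k => by
    obtain ⟨f, h1, h0, hf, -⟩ := exists_continuous_one_zero_of_isCompact
      (isCompact_singleton (x := (k : Ω))) (s.erase k).finite_toSet.isClosed
      (disjoint_singleton_left.mpr (by simp))
    refine ⟨⟨f, hf.is_zero_at_infty⟩, funext fun j => ?_⟩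
    rw [Pi.single_apply]
    split_ifs with hj
    · exact h1 (congrArg Subtype.val hj)
    · exact h0 (Finset.mem_erase.mpr ⟨fun h => hj (Subtype.ext h), j.2⟩)
  rw [← LinearMap.range_eq_top, eq_top_iff, ← (Pi.basisFun ℝ s).span_eq, Submodule.span_le]
  rintro _ ⟨k, rfl⟩
  simpa using hsingle k

variable [MeasurableSpace Ω] [BorelSpace Ω] {w : StrongDual ℝ C₀(Ω, ℝ)} {η : C₀(Ω, ℝ)}
  {μ : Measure Ω} [IsFiniteMeasure μ]

theorem apply_eq_zero_of_integral_mul_self_eq_zero {τ : C₀(Ω, ℝ)}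
    (h : ∫ x, τ x * τ x ∂μ = 0) {x : Ω} (hx : x ∈ μ.support) : τ x = 0 := by
  have hae : ∀ᵐ x ∂μ, τ x * τ x = 0 :=
    (integral_eq_zero_iff_of_nonneg (fun x => mul_self_nonneg (τ x))
      (integrable_zeroAtInfty μ (τ * τ))).mp h
  have hclosed : IsClosed {x | τ x = 0} := isClosed_eq τ.continuous continuous_const
  exact Measure.support_subset_of_isClosed hclosed
    (hae.mono fun x hx => mul_self_eq_zero.mp hx) hx

/-- The perturbations `η τ μ`, `τ ∈ C₀(Ω)`, of `w = η μ`. -/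
def perturbation (η : C₀(Ω, ℝ)) (μ : Measure Ω) [IsFiniteMeasure μ] :
    C₀(Ω, ℝ) →ₗ[ℝ] StrongDual ℝ C₀(Ω, ℝ) :=
  (density μ).toLinearMap ∘ₗ LinearMap.mulLeft ℝ η

theorem perturbation_apply (τ : C₀(Ω, ℝ)) : perturbation η μ τ = density μ (η * τ) := rfl

namespace IsPolar

theorem ker_perturbation_le (h : IsPolar w η μ) {s : Finset Ω} (hs : ↑s ⊆ μ.support) :
    LinearMap.ker (perturbation η μ) ≤ LinearMap.ker (evalFinset s) := by
  intro τ hτ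
  have hsq : ∫ x, τ x * τ x ∂μ = 0 := by
    calc ∫ x, τ x * τ x ∂μ = ∫ x, (η * τ) x * (η * τ) x ∂μ := by
          refine integral_congr_ae (h.ae_abs_eq_one.mono fun x hx => ?_)
          change τ x * τ x = η x * τ x * (η x * τ x)
          rw [mul_mul_mul_comm, ← abs_mul_abs_self (η x), hx, one_mul, one_mul]
      _ = perturbation η μ τ (η * τ) := rfl
      _ = 0 := by rw [LinearMap.mem_ker.mp hτ, _root_.zero_apply]
  exact LinearMap.mem_ker.mpr
    (funext fun x => apply_eq_zero_of_integral_mul_self_eq_zero hsq (hs x.2))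

variable {X Y : Type*} [AddCommGroup X] [Module ℝ X] [AddCommGroup Y] [Module ℝ Y]
  {E : Y → ℝ≥0∞} {lam : ℝ} {H : X →ₗ[ℝ] Y} {T : X →ₗ[ℝ] StrongDual ℝ C₀(Ω, ℝ)} {f : X}

theorem eq_zero_of_mem_range_perturbation (hlam : 0 < lam) (hfeas : ∃ g, E (H g) ≠ ⊤)
    (hf : f ∈ (regMinimizers (W := StrongDual ℝ C₀(Ω, ℝ)) E lam H T).extremePoints ℝ)
    (hpolar : IsPolar (T f) η μ)
    {h : X} (hTh : T h ∈ LinearMap.range (perturbation η μ)) (hHh : H h = 0) : h = 0 := by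
  obtain ⟨τ, hτ⟩ := hTh
  let s : ℝ := (‖τ‖ + 1)⁻¹
  have hs : 0 < s := by positivity
  have hsτ : ‖s • τ‖ ≤ 1 := by
    rw [norm_smul, Real.norm_of_nonneg hs.le, inv_mul_le_one₀ (by positivity)]
    linarith
  have hadd : T (f + s • h) = T f + density μ (η * (s • τ)) := by
    rw [map_add, map_smul, ← hτ, ← map_smul, perturbation_apply]
  have hsub : T (f - s • h) = T f + density μ (η * -(s • τ)) := by
    rw [sub_eq_add_neg, ← smul_neg, map_add, map_smul, map_neg, ← hτ, ← map_neg, ← map_smul,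
      perturbation_apply]
    congr 3
    exact smul_neg s τ
  have hzero : s • h = 0 := by
    refine eq_zero_of_mem_extremePoints_regMinimizers hlam hfeas hf
      (by rw [map_smul, hHh, smul_zero]) (c := ∫ x, (s • τ) x ∂μ) ?_ ?_
    · rw [hadd, hpolar.norm_eq]
      exact hpolar.norm_add_density_le hsτ
    · rw [hsub, hpolar.norm_eq, sub_eq_add_neg, ← integral_neg]
      exact hpolar.norm_add_density_le (by rwa [norm_neg])
  exact (smul_eq_zero.mp hzero).resolve_left hs.ne'

theorem card_add_finrank_ker_le [LocallyCompactSpace Ω] [T2Space Ω]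
    [Module.Finite ℝ Y] (hlam : 0 < lam) (hfeas : ∃ g, E (H g) ≠ ⊤)
    (hf : f ∈ (regMinimizers (W := StrongDual ℝ C₀(Ω, ℝ)) E lam H T).extremePoints ℝ)
    (hpolar : IsPolar (T f) η μ) (hrange : LinearMap.range (perturbation η μ) ≤ LinearMap.range T)
    {s : Finset Ω} (hs : ↑s ⊆ μ.support) :
    s.card + Module.finrank ℝ (LinearMap.ker T) ≤ Module.finrank ℝ Y := by
  have hinj (h : X) (hTh : T h ∈ LinearMap.range (perturbation η μ)) (hHh : H h = 0) : h = 0 :=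
    hpolar.eq_zero_of_mem_range_perturbation hlam hfeas hf hTh hHh
  have hrank := finrank_add_finrank_ker_le_of_surjective (W := StrongDual ℝ C₀(Ω, ℝ)) H T
    (perturbation η μ) (evalFinset s) hrange hinj (evalFinset_surjective s)
    (hpolar.ker_perturbation_le hs)
  rwa [Module.finrank_fintype_fun_eq_card, Fintype.card_coe] at hrank

theorem finite_support_of_mem_extremePoints [LocallyCompactSpace Ω] [T2Space Ω]
    [Module.Finite ℝ Y] (hlam : 0 < lam) (hfeas : ∃ g, E (H g) ≠ ⊤)
    (hf : f ∈ (regMinimizers (W := StrongDual ℝ C₀(Ω, ℝ)) E lam H T).extremePoints ℝ)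
    (hpolar : IsPolar (T f) η μ)
    (hrange : LinearMap.range (perturbation η μ) ≤ LinearMap.range T) : μ.support.Finite := by
  by_contra hinf
  obtain ⟨s, hs, hcard⟩ :=
    Set.Infinite.exists_subset_card_eq hinf (Module.finrank ℝ Y + 1)
  have := hpolar.card_add_finrank_ker_le hlam hfeas hf hrange hs
  omega

theorem exists_eq_sum_of_mem_extremePoints [LocallyCompactSpace Ω] [T2Space Ω]
    [HereditarilyLindelofSpace Ω] [Module.Finite ℝ Y] (hlam : 0 < lam)
    (hfeas : ∃ g, E (H g) ≠ ⊤)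
    (hf : f ∈ (regMinimizers (W := StrongDual ℝ C₀(Ω, ℝ)) E lam H T).extremePoints ℝ)
    (hpolar : IsPolar (T f) η μ)
    (hrange : LinearMap.range (perturbation η μ) ≤ LinearMap.range T) :
    ∃ (K : ℕ) (x : Fin K → Ω) (a : Fin K → ℝ), Function.Injective x ∧
      K + Module.finrank ℝ (LinearMap.ker T) ≤ Module.finrank ℝ Y ∧
      (∀ g, T f g = ∑ k, a k * g (x k)) ∧ ‖T f‖ = ∑ k, |a k| := by
  classical
  obtain ⟨K, x, hx, hrangex⟩ :=
    (hpolar.finite_support_of_mem_extremePoints hlam hfeas hf hrange).fin_param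
  have hμ : ∀ᵐ y ∂μ, y ∈ range x := hrangex ▸ Measure.support_mem_ae
  obtain ⟨a, hsum, hnorm⟩ := hpolar.exists_eq_sum hx hμ
  have hcard := hpolar.card_add_finrank_ker_le hlam hfeas hf hrange
    (s := Finset.univ.image x) (by simp [hrangex])
  rw [Finset.card_image_of_injective _ hx, Finset.card_fin] at hcard
  exact ⟨K, x, a, hx, hcard, hsum, hnorm⟩

end IsPolar

end Sparsity

section Representer

variable {Ω : Type*} [TopologicalSpace Ω] [MeasurableSpace Ω] [BorelSpace Ω]
  {X : Type*} [AddCommGroup X] [Module ℝ X] {T : X →ₗ[ℝ] StrongDual ℝ C₀(Ω, ℝ)}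

/-- The range of `T` contains all functionals `θ μ` with `θ ∈ C₀(Ω)` and `μ` a finite measure
concentrated on a compact set. This is what the existence of a Green's function amounts to for
operators that are not shift-invariant. -/
def RangeContainsDensities (T : X →ₗ[ℝ] StrongDual ℝ C₀(Ω, ℝ)) : Prop :=
  ∀ (μ : Measure Ω) [IsFiniteMeasure μ] (K : Set Ω), IsCompact K → (∀ᵐ x ∂μ, x ∈ K) →
    ∀ θ : C₀(Ω, ℝ), density μ θ ∈ LinearMap.range T

namespace RangeContainsDensities

variable {w : StrongDual ℝ C₀(Ω, ℝ)} {η : C₀(Ω, ℝ)} {μ : Measure Ω} [IsFiniteMeasure μ]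

theorem mem_range (hT : RangeContainsDensities T) (h : IsPolar w η μ) :
    w ∈ LinearMap.range T := by
  obtain ⟨K, hK, hμK⟩ := h.exists_isCompact_ae_mem
  exact h.eq_density ▸ hT μ K hK hμK η

theorem range_perturbation_le (hT : RangeContainsDensities T) (h : IsPolar w η μ) :
    LinearMap.range (perturbation η μ) ≤ LinearMap.range T := by
  obtain ⟨K, hK, hμK⟩ := h.exists_isCompact_ae_mem
  rintro _ ⟨τ, rfl⟩
  exact hT μ K hK hμK (η * τ)

end RangeContainsDensities

variable [LocallyCompactSpace Ω] [T2Space Ω] {ι κ : Type*} [Finite κ] {φ : ι → X →ₗ[ℝ] ℝ}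
  {E : (κ → ℝ) → ℝ≥0∞} {lam : ℝ} {A : WeakDual ℝ C₀(Ω, ℝ) × (ι → ℝ) →L[ℝ] (κ → ℝ)}

theorem exists_isPolar_of_mem_dual_regMinimizers
    (hlam : 0 < lam) (hfeas : ∃ y, E (A y) ≠ ⊤) {y : WeakDual ℝ C₀(Ω, ℝ) × (ι → ℝ)}
    (hy : y ∈ regMinimizers E lam A.toLinearMap (dualPart C₀(Ω, ℝ) (ι → ℝ))) :
    ∃ (η : C₀(Ω, ℝ)) (μ : Measure Ω) (_ : IsFiniteMeasure μ),
      IsPolar (dualPart C₀(Ω, ℝ) (ι → ℝ) y) η μ := by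
  obtain ⟨η, hη, hw⟩ := exists_apply_eq_norm_of_mem_dual_regMinimizers hlam hfeas hy
  exact ⟨η, exists_isPolar hη hw⟩

variable [Finite ι] [DecidableEq ι] {p : Module.Basis ι ℝ (LinearMap.ker T)}

theorem dual_regMinimizers_subset_range_embed
    (hT : RangeContainsDensities T) (hφ : ∀ m n, φ m (p n) = if m = n then 1 else 0)
    (hlam : 0 < lam) (hfeas : ∃ y, E (A y) ≠ ⊤) :
    regMinimizers E lam A.toLinearMap (dualPart C₀(Ω, ℝ) (ι → ℝ)) ⊆ range (embed T φ) := by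
  intro y hy
  obtain ⟨η, μ, _, hpolar⟩ := exists_isPolar_of_mem_dual_regMinimizers hlam hfeas hy
  rw [range_embed hφ]
  exact hT.mem_range hpolar

/-- The problem over `X` has the same solutions as its relaxation to `C₀(Ω)' × ℝ^ι`, which
can be solved by weak* compactness. -/
theorem exists_relaxation {H : X →ₗ[ℝ] κ → ℝ} (hT : RangeContainsDensities T)
    (hφ : ∀ m n, φ m (p n) = if m = n then 1 else 0)
    (hH : Continuous[TopologicalSpace.induced (embed T φ) inferInstance, inferInstance] H)
    (hker : ∀ q ∈ LinearMap.ker T, H q = 0 → q = 0) (hE : LowerSemicontinuous E)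
    (hcoer : Tendsto E (cocompact (κ → ℝ)) (𝓝 ⊤)) (hfeas : ∃ x, E (H x) ≠ ⊤) (hlam : 0 < lam) :
    ∃ A : WeakDual ℝ C₀(Ω, ℝ) × (ι → ℝ) →L[ℝ] (κ → ℝ), (∃ y, E (A y) ≠ ⊤) ∧
      (regMinimizers E lam A.toLinearMap (dualPart C₀(Ω, ℝ) (ι → ℝ))).Nonempty ∧
      IsCompact (regMinimizers E lam A.toLinearMap (dualPart C₀(Ω, ℝ) (ι → ℝ))) ∧
      regMinimizers E lam A.toLinearMap (dualPart C₀(Ω, ℝ) (ι → ℝ)) ⊆ range (embed T φ) ∧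
      regMinimizers (W := StrongDual ℝ C₀(Ω, ℝ)) E lam H T =
        embed T φ ⁻¹' regMinimizers E lam A.toLinearMap (dualPart C₀(Ω, ℝ) (ι → ℝ)) := by
  obtain ⟨A, hAH⟩ := exists_comp_embed_eq hH
  have hA := eq_zero_of_apply_inr_eq_zero hφ hAH hker
  have hfeasA : ∃ y, E (A y) ≠ ⊤ := hfeas.imp' (embed T φ) fun x hx => by rwa [hAH]
  have hfeasCost : ∃ y, regCost E lam A.toLinearMap (dualPart C₀(Ω, ℝ) (ι → ℝ)) y ≠ ⊤ :=
    hfeasA.imp fun y hy => ENNReal.add_ne_top.mpr ⟨hy, ENNReal.ofReal_ne_top⟩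
  have hsub (r : ℝ≥0∞) (hr : r ≠ ⊤) := isCompact_dual_regCost_le hE hcoer hlam hA hr
  have hne := nonempty_argmin_of_isCompact_le (lowerSemicontinuous_regCost hE hlam.le A.continuous
    lowerSemicontinuous_norm_dualPart) hsub hfeasCost
  have hrange := dual_regMinimizers_subset_range_embed hT hφ hlam hfeasA
  exact ⟨A, hfeasA, hne, isCompact_argmin_of_isCompact_le hsub hfeasCost, hrange,
    regMinimizers_eq_preimage hAH (fun _ => rfl) hne hrange⟩

end Representer

section Convolution

theorem shift_ae_eq (a : ℝ) (f : Fn) : shift a f =ᵐ[volume] fun x => f (x - a) :=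
  AEEqFun.coeFn_compMeasurePreserving f (measurePreserving_sub_right volume a)

theorem measurable_coe (f : Fn) : Measurable f := f.stronglyMeasurable.measurable

theorem measurable_conv_kernel (f g : Fn) (θ : C₀(ℝ, ℝ)) :
    Measurable fun q : ℝ × ℝ => f (q.1 - q.2) * θ q.2 * g q.1 :=
  (((measurable_coe f).comp (measurable_fst.sub measurable_snd)).mul
    (θ.continuous.measurable.comp measurable_snd)).mul ((measurable_coe g).comp measurable_fst)

/-- The convolution of the function `f` with the measure `θ μ`. For a Green's function `f` of `L`,
it is a right inverse of `L` on compactly supported measures. -/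
def conv (f : Fn) (μ : Measure ℝ) [IsFiniteMeasure μ] (θ : C₀(ℝ, ℝ)) : Fn :=
  AEEqFun.mk (fun x => ∫ y, f (x - y) * θ y ∂μ) <|
    Measurable.aestronglyMeasurable <| StronglyMeasurable.measurable <|
      (((measurable_coe f).comp (measurable_fst.sub measurable_snd)).mul
        (θ.continuous.measurable.comp measurable_snd)).stronglyMeasurable.integral_prod_right

variable {μ : Measure ℝ} [IsFiniteMeasure μ]

theorem conv_mul_ae_eq (f g : Fn) (θ : C₀(ℝ, ℝ)) :
    (fun x => conv f μ θ x * g x) =ᵐ[volume] fun x => ∫ y, f (x - y) * θ y * g x ∂μ := by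
  filter_upwards [AEEqFun.coeFn_mk (fun x => ∫ y, f (x - y) * θ y ∂μ) _] with x hx
  rw [integral_mul_const]
  exact congrArg (· * g x) hx

namespace LSIOperator

variable {L : LSIOperator} {f ρ : Fn}

theorem adj_shiftTest_neg_ae_eq (y : ℝ) (ψ : 𝓢(ℝ, ℝ)) :
    L.adj (shiftTest (-y) ψ) =ᵐ[volume] fun x => L.adj ψ (x + y) := by
  rw [L.adj_shift]
  simpa only [sub_neg_eq_add] using shift_ae_eq (-y) (L.adj ψ)

theorem lintegral_enorm_shift_mul_adj (f : Fn) (y : ℝ) (ψ : 𝓢(ℝ, ℝ)) :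
    ∫⁻ x, ‖f (x - y) * L.adj ψ x‖ₑ = ∫⁻ x, ‖f x * L.adj (shiftTest (-y) ψ) x‖ₑ := by
  rw [← lintegral_add_right_eq_self (fun x => ‖f (x - y) * L.adj ψ x‖ₑ) y]
  refine lintegral_congr_ae ?_
  filter_upwards [adj_shiftTest_neg_ae_eq (L := L) y ψ] with x hx
  rw [hx, add_sub_cancel_right]

theorem integral_shift_mul_adj (f : Fn) (y : ℝ) (ψ : 𝓢(ℝ, ℝ)) :
    ∫ x, f (x - y) * L.adj ψ x = ∫ x, f x * L.adj (shiftTest (-y) ψ) x := by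
  rw [← integral_add_right_eq_self (fun x => f (x - y) * L.adj ψ x) y]
  refine integral_congr_ae ?_
  filter_upwards [adj_shiftTest_neg_ae_eq (L := L) y ψ] with x hx
  rw [hx, add_sub_cancel_right]

namespace Applies

theorem exists_lintegral_shift_le (hf : L.Applies f) (ψ : 𝓢(ℝ, ℝ)) (R S : ℝ) :
    ∃ C : ℝ≥0, ∀ a ∈ Icc (-R) R, ∀ y, |y| ≤ S →
      ∫⁻ x, ‖f (x - y) * L.adj (shiftTest a ψ) x‖ₑ ≤ C := by
  obtain ⟨C, hC⟩ := hf ψ (R + S)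
  refine ⟨C, fun a ha y hy => ?_⟩
  have hcomp : shiftTest (-y) (shiftTest a ψ) = shiftTest (a + -y) ψ :=
    SchwartzMap.compSubConstCLM_comp ψ a (-y)
  rw [lintegral_enorm_shift_mul_adj, hcomp]
  exact hC _ ⟨by linarith [ha.1, (abs_le.mp hy).2], by linarith [ha.2, (abs_le.mp hy).1]⟩

protected theorem shift (hf : L.Applies f) (y : ℝ) : L.Applies (shift y f) := by
  intro ψ R
  obtain ⟨C, hC⟩ := hf.exists_lintegral_shift_le ψ R |y|
  refine ⟨C, fun a ha => (lintegral_congr_ae ?_).trans_le (hC a ha y le_rfl)⟩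
  filter_upwards [shift_ae_eq y f] with x hx
  rw [hx]

theorem exists_lintegral_lintegral_le (hf : L.Applies f) {S : ℝ} (hS : ∀ᵐ y ∂μ, |y| ≤ S)
    (θ : C₀(ℝ, ℝ)) (ψ : 𝓢(ℝ, ℝ)) (R : ℝ) :
    ∃ C : ℝ≥0, ∀ a ∈ Icc (-R) R,
      ∫⁻ x, ∫⁻ y, ‖f (x - y) * θ y * L.adj (shiftTest a ψ) x‖ₑ ∂μ ≤ C := by
  obtain ⟨C, hC⟩ := hf.exists_lintegral_shift_le ψ R S
  refine ⟨‖θ‖₊ * C * (μ univ).toNNReal, fun a ha => ?_⟩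
  have hinner (y : ℝ) (hy : |y| ≤ S) :
      ∫⁻ x, ‖f (x - y) * θ y * L.adj (shiftTest a ψ) x‖ₑ ≤ ‖θ‖ₑ * C := calc
    _ = ‖θ y‖ₑ * ∫⁻ x, ‖f (x - y) * L.adj (shiftTest a ψ) x‖ₑ := by
      rw [← lintegral_const_mul' _ _ enorm_ne_top]
      simp only [← enorm_mul, mul_left_comm (θ y), mul_assoc]
    _ ≤ ‖θ‖ₑ * C := mul_le_mul' (enorm_le_iff_norm_le.mpr (abs_apply_le_norm θ y)) (hC a ha y hy)
  rw [lintegral_lintegral_swap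
    (measurable_conv_kernel f (L.adj (shiftTest a ψ)) θ).enorm.aemeasurable]
  calc _ ≤ ∫⁻ _, ‖θ‖ₑ * C ∂μ := lintegral_mono_ae (hS.mono hinner)
    _ = ((‖θ‖₊ * C * (μ univ).toNNReal : ℝ≥0) : ℝ≥0∞) := by
      rw [lintegral_const, ENNReal.coe_mul, ENNReal.coe_mul,
        ENNReal.coe_toNNReal (measure_ne_top μ univ), enorm_eq_nnnorm]

protected theorem conv (hf : L.Applies f) {S : ℝ} (hS : ∀ᵐ y ∂μ, |y| ≤ S) (θ : C₀(ℝ, ℝ)) :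
    L.Applies (conv f μ θ) := by
  intro ψ R
  obtain ⟨C, hC⟩ := hf.exists_lintegral_lintegral_le hS θ ψ R
  refine ⟨C, fun a ha => (lintegral_mono_ae ?_).trans (hC a ha)⟩
  filter_upwards [conv_mul_ae_eq (μ := μ) f (L.adj (shiftTest a ψ)) θ] with x hx
  rw [hx]
  exact enorm_integral_le_lintegral_enorm _

theorem integrable_conv_kernel (hf : L.Applies f) {S : ℝ} (hS : ∀ᵐ y ∂μ, |y| ≤ S)
    (θ : C₀(ℝ, ℝ)) (ψ : 𝓢(ℝ, ℝ)) :
    Integrable (Function.uncurry fun x y => f (x - y) * θ y * L.adj ψ x) (volume.prod μ) := by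
  have hmeas := measurable_conv_kernel f (L.adj ψ) θ
  obtain ⟨C, hC⟩ := hf.exists_lintegral_lintegral_le hS θ ψ 0
  have hle := hC 0 (by simp)
  rw [shiftTest_zero] at hle
  exact ⟨hmeas.aestronglyMeasurable,
    ((lintegral_prod _ hmeas.enorm.aemeasurable).trans_le hle).trans_lt ENNReal.coe_lt_top⟩

end Applies

theorem maps_op (f : L.searchSpace) : L.Maps f (L.op f) := f.2.2.choose_spec

theorem Maps.op_eq {f : L.searchSpace} {w : Meas} (h : L.Maps f w) : L.op f = w :=
  (maps_op f).unique h

namespace IsGreen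

theorem applies (hρ : L.IsGreen ρ) : L.Applies ρ := hρ.1.1

theorem integral_shift_mul_adj (hρ : L.IsGreen ρ) (y : ℝ) (ψ : 𝓢(ℝ, ℝ)) :
    ∫ x, ρ (x - y) * L.adj ψ x = ψ y := by
  obtain ⟨hmem, hδ⟩ := hρ
  have heval := maps_op ⟨ρ, hmem⟩ (shiftTest (-y) ψ)
  rw [hδ] at heval
  rw [LSIOperator.integral_shift_mul_adj, heval]
  change ψ (0 - -y) = ψ y
  rw [zero_sub, neg_neg]

theorem maps_shift (hρ : L.IsGreen ρ) (y : ℝ) : L.Maps (shift y ρ) (dirac y) := by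
  intro ψ
  refine (integral_congr_ae ?_).trans (hρ.integral_shift_mul_adj y ψ)
  filter_upwards [shift_ae_eq y ρ] with x hx
  rw [hx]

theorem maps_conv (hρ : L.IsGreen ρ) {S : ℝ} (hS : ∀ᵐ y ∂μ, |y| ≤ S) (θ : C₀(ℝ, ℝ)) :
    L.Maps (conv ρ μ θ) (density μ θ) := by
  intro ψ
  calc ∫ x, conv ρ μ θ x * L.adj ψ x
      = ∫ x, ∫ y, ρ (x - y) * θ y * L.adj ψ x ∂μ := integral_congr_ae (conv_mul_ae_eq ρ _ θ)
    _ = ∫ y, ∫ x, ρ (x - y) * θ y * L.adj ψ x ∂volume ∂μ :=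
      integral_integral_swap (hρ.applies.integrable_conv_kernel hS θ ψ)
    _ = ∫ y, θ y * ψ y ∂μ := by
      refine integral_congr_ae (Eventually.of_forall fun y => ?_)
      simp only [mul_comm _ (θ y), mul_assoc, integral_const_mul, hρ.integral_shift_mul_adj]
    _ = density μ θ ψ.toZeroAtInfty := rfl

theorem rangeContainsDensities (hρ : L.IsGreen ρ) : RangeContainsDensities L.op := by
  intro μ _ K hK hμK θ
  obtain ⟨S, hKS⟩ := hK.isBounded.exists_norm_le
  have hS : ∀ᵐ y ∂μ, |y| ≤ S := hμK.mono hKS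
  have hmaps := hρ.maps_conv hS θ
  exact ⟨⟨conv ρ μ θ, hρ.applies.conv hS θ, _, hmaps⟩, Maps.op_eq hmaps⟩

end IsGreen

end LSIOperator

end Convolution

namespace LSIOperator

variable {L : LSIOperator} {M N₀ : ℕ} {ρ : Fn} {p : Module.Basis (Fin N₀) ℝ L.nullSpace}
  {φ : Fin N₀ → L.searchSpace →ₗ[ℝ] ℝ} {H : L.searchSpace →ₗ[ℝ] (Fin M → ℝ)}
  {E : (Fin M → ℝ) → (Fin M → ℝ) → ℝ≥0∞} {z : Fin M → ℝ} {lam : ℝ}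

variable (L φ) in
theorem weakStar_eq_induced :
    L.weakStar φ = TopologicalSpace.induced (embed L.op φ) inferInstance := by
  have hV : IsInducing fun (w : WeakDual ℝ C₀(ℝ, ℝ)) (ψ : C₀(ℝ, ℝ)) => w ψ := ⟨rfl⟩
  rw [(hV.prodMap (IsInducing.id (X := Fin N₀ → ℝ))).eq_induced, induced_compose]
  rfl

variable (L) in
theorem minimizers_eq_regMinimizers :
    L.minimizers E z lam H = regMinimizers (W := Meas) (E z) lam H L.op := rfl

theorem IsGreen.exists_eq_sum_shift (hρ : L.IsGreen ρ) (p : Module.Basis (Fin N₀) ℝ L.nullSpace)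
    {f : L.searchSpace} {K : ℕ} {x a : Fin K → ℝ} (hf : L.op f = ∑ k, a k • dirac (x k)) :
    ∃ b : Fin N₀ → ℝ, (f : Fn) =
      ∑ k, a k • shift (x k) ρ + ∑ n, b n • ((p n : L.searchSpace) : Fn) := by
  let atom (y : ℝ) : L.searchSpace := ⟨shift y ρ, hρ.applies.shift y, _, hρ.maps_shift y⟩
  have hatom (y : ℝ) : L.op (atom y) = dirac y := Maps.op_eq (hρ.maps_shift y)
  let q : L.nullSpace := ⟨f - ∑ k, a k • atom (x k), by
    rw [LinearMap.mem_ker, map_sub, hf, map_sum, sub_eq_zero]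
    simp only [map_smul, hatom]⟩
  have hq : ((q : L.searchSpace) : Fn) = ∑ n, p.repr q n • ((p n : L.searchSpace) : Fn) := by
    conv_lhs => rw [← p.sum_repr q]
    simp only [Submodule.coe_sum, Submodule.coe_smul]
  refine ⟨p.repr q, ?_⟩
  rw [← hq]
  simp [q, atom]

theorem exists_spline_of_mem_extremePoints (hρ : L.IsGreen ρ)
    (p : Module.Basis (Fin N₀) ℝ L.nullSpace) (hlam : 0 < lam) (hfeas : ∃ f, E z (H f) ≠ ⊤)
    {f : L.searchSpace} (hf : f ∈ (L.minimizers E z lam H).extremePoints ℝ)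
    {η : C₀(ℝ, ℝ)} {μ : Measure ℝ} [IsFiniteMeasure μ] (hpolar : IsPolar (L.op f) η μ) :
    ∃ (K : ℕ) (x a : Fin K → ℝ) (b : Fin N₀ → ℝ), K + N₀ ≤ M ∧ L.IsSpline f x a ∧
      (f : Fn) = ∑ k, a k • shift (x k) ρ + ∑ n, b n • ((p n : L.searchSpace) : Fn) ∧
      ‖L.op f‖ = ∑ k, |a k| := by
  obtain ⟨K, x, a, hx, hK, hsum, hnorm⟩ := hpolar.exists_eq_sum_of_mem_extremePoints hlam hfeas hf
    (hρ.rangeContainsDensities.range_perturbation_le hpolar)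
  have hdirac : L.op f = ∑ k, a k • dirac (x k) := by
    ext g
    rw [hsum, sum_apply]
    rfl
  obtain ⟨b, hb⟩ := hρ.exists_eq_sum_shift p hdirac
  rw [Module.finrank_eq_card_basis p, Fintype.card_fin, Module.finrank_fin_fun] at hK
  exact ⟨K, x, a, b, hK, ⟨hx, hdirac⟩, hb, hnorm⟩

end LSIOperator

end GTV

end

theorem theorem2 {M N₀ : ℕ} (L : GTV.LSIOperator) (hL : L.SplineAdmissible)
    (ρ : GTV.Fn) (hρ : L.IsGreen ρ)
    (p : Module.Basis (Fin N₀) ℝ L.nullSpace)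
    (φ : Fin N₀ → L.searchSpace →ₗ[ℝ] ℝ) (hφ : L.Biorthonormal p φ)
    (H : L.searchSpace →ₗ[ℝ] (Fin M → ℝ))
    (hH : Continuous[L.weakStar φ, inferInstance] H)
    (hwell : ∀ q₁ ∈ L.nullSpace, ∀ q₂ ∈ L.nullSpace, H q₁ = H q₂ ↔ q₁ = q₂)
    (E : (Fin M → ℝ) → (Fin M → ℝ) → ℝ≥0∞) (z : Fin M → ℝ)
    (hconv : ConvexOn ℝ≥0 univ (E z))
    (hlsc : LowerSemicontinuous (E z))
    (hcoer : Tendsto (E z) (cocompact (Fin M → ℝ)) (𝓝 ⊤))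
    (hfeas : ∃ f, E z (H f) ≠ ⊤)
    (lam : ℝ) (hlam : 0 < lam) :
    (L.minimizers E z lam H).Nonempty ∧
    Convex ℝ (L.minimizers E z lam H) ∧
    @IsCompact _ (L.weakStar φ) (L.minimizers E z lam H) ∧
    closure[L.weakStar φ] (convexHull ℝ ((L.minimizers E z lam H).extremePoints ℝ)) =
      L.minimizers E z lam H ∧
    ∀ f ∈ (L.minimizers E z lam H).extremePoints ℝ,
      ∃ (K : ℕ) (x a : Fin K → ℝ) (b : Fin N₀ → ℝ),
        K + N₀ ≤ M ∧
        L.IsSpline f x a ∧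
        (f : GTV.Fn) = ∑ k, a k • GTV.shift (x k) ρ + ∑ n, b n • ((p n : L.searchSpace) : GTV.Fn) ∧
        ‖L.op f‖ = ∑ k, |a k| := by
  have hker (q : L.searchSpace) (hq : q ∈ L.nullSpace) (hHq : H q = 0) : q = 0 :=
    (hwell q hq 0 (zero_mem _)).mp (hHq.trans (map_zero H).symm)
  rw [L.weakStar_eq_induced φ] at hH ⊢
  rw [L.minimizers_eq_regMinimizers]
  obtain ⟨A, hfeasA, hne, hcomp, hrange, hmin⟩ := GTV.exists_relaxation
    hρ.rangeContainsDensities hφ hH hker hlsc hcoer hfeas hlam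
  have hconvex := GTV.convex_regMinimizers (W := GTV.Meas) hconv hlam.le (H := H) (T := L.op)
  let _ : TopologicalSpace L.searchSpace := .induced (GTV.embed L.op φ) inferInstance
  have hcompact := IsInducing.isCompact_preimage' (f := GTV.embed L.op φ) ⟨rfl⟩ hcomp hrange
  rw [← hmin] at hcompact
  refine ⟨hmin ▸ hne.preimage' hrange, hconvex, hcompact,
    GTV.closure_convexHull_extremePoints_induced (GTV.embed_injective hφ) hcompact hconvex,
    fun f hf => ?_⟩
  obtain ⟨η, μ, _, hpolar⟩ :=
    GTV.exists_isPolar_of_mem_dual_regMinimizers hlam hfeasA (hmin ▸ hf.1)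
  exact GTV.LSIOperator.exists_spline_of_mem_extremePoints hρ p hlam hfeas hf hpolar
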